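/- Let $d\ge 0$ and $N\ge 1$ be integers, let $\Phi=\{\phi_a\}_{a\in\mathcal A}$, $\mathcal A=\{1,\dots,N\}$, be an iterated function system on $\mathbb{R}^d$ (with the Euclidean norm $\|\cdot\|$) of the form $$\phi_a(x)=\frac{x+\mathbf p_a}{q_a},\qquad \mathbf p_a\in\mathbb Z^d,\ q_a\in\mathbb Z,\ |q_a|\ge 2 .$$ Let $X$ be its self-similar set, i.e. the unique non-empty compact set with $X=\bigcup_{a}\phi_a(X)$; let $r_a=1/|q_a|$, let $\dim_S(\Phi)$ be the unique real $s$ with $\sum_a r_a^s=1$, put $p_a=r_a^{\dim_S(\Phi)}$ and $h_{\mathbf p}=-\sum_a p_a\log p_a$, and let $\mu$ be the unique Borel probability measure with $\mu=\sum_a p_a\,(\phi_a)_*\mu$. For a word $\mathbf a=(a_1,\dots,a_n)\in\mathcal A^n$ write $\phi_{\mathbf a}=\phi_{a_1}\circ\cdots\circ\phi_{a_n}$ and $X_{\mathbf a}=\phi_{\mathbf a}(X)$, and let $\pi((a_n)_{n\ge1})=\lim_{n\to\infty}(\phi_{a_1}\circ\cdots\circ\phi_{a_n})(0)$. For a rational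 point $y\in X\cap\mathbb Q^d$ let $n(y)$ be the least $n\ge1$ such that $y=\pi(a_1\ldots a_l(a_{l+1}\ldots a_n)^\infty)$ for some $a_1,\dots,a_n\in\mathcal A$ and some $0\le l\le n-1$. Assume that $\Phi$ satisfies the strong separation condition, $\phi_a(X)\cap\phi_{b}(X)=\emptyset$ for all $a\ne b$, and that $$h_{\mathbf p}<-2\log\sum_{a\in\mathcal A}p_a^2 .$$ Let $g:\mathbb N\to[0,\infty)$ ($\mathbb N=\{1,2,\dots\}$) be non-increasing with $$\sum_{n=1}^\infty\sum_{\mathbf a\in\mathcal A^n} n\,\bigl(\mathrm{Diam}(X_{\mathbf a})\,g(n)\bigr)^{\dim_S(\Phi)}=\infty .$$ Then $$\mu\Bigl(\Bigl\{x\in X:\ \|x-\mathbf p/q\|<\frac{g(n(\mathbf p/q))}{q}\ \text{ for infinitely many rational points }\mathbf p/q\in X\Bigr\}\Bigr)=1,$$ where each rational point is written in reduced form: $\mathbf p=(\mathbf p_1,\dots,\mathbf p_d)\in\mathbb Z^d$, $q\ge1$, $\gcd(\mathbf p_1,\dots,\mathbf p_d,q)=1$. -/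

import Mathlib

open Filter Topology MeasureTheory

/-- A finite family, indexed by the alphabet `Fin N`, of contracting similarities of `ℝ^d` of the
form `x ↦ (x + p_a) / q_a` with `p_a ∈ ℤ^d`, `q_a ∈ ℤ` and `|q_a| ≥ 2`. -/
structure RationalIFS (d N : ℕ) where
  /-- The integer translation vectors. -/
  p : Fin N → Fin d → ℤ
  /-- The integer denominators. -/
  q : Fin N → ℤ
  two_le_abs_q : ∀ a, 2 ≤ |q a|

namespace RationalIFS

noncomputable section

variable {d N : ℕ} (Φ : RationalIFS d N)

/-- The similarity `φ_a(x) = (x + p_a) / q_a`. -/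
def map (a : Fin N) (x : EuclideanSpace ℝ (Fin d)) : EuclideanSpace ℝ (Fin d) :=
  ((Φ.q a : ℝ)⁻¹) • (x + WithLp.toLp 2 (fun i => (Φ.p a i : ℝ)))

/-- The contraction ratio `r_a = 1 / |q_a|` of `φ_a`. -/
def ratio (a : Fin N) : ℝ := |(Φ.q a : ℝ)|⁻¹

/-- For a word `a = (a_1, …, a_n)`, the composition `φ_{a_1} ∘ ⋯ ∘ φ_{a_n}`. -/
def wordMap {n : ℕ} (a : Fin n → Fin N) : EuclideanSpace ℝ (Fin d) → EuclideanSpace ℝ (Fin d) :=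
  (List.ofFn a).foldr (fun b f => Φ.map b ∘ f) id

/-- The coding map `π((a_n)) = lim_n (φ_{a_1} ∘ ⋯ ∘ φ_{a_n})(0)` (the limit exists, see
`tendsto_coding`). -/
def coding (ω : ℕ → Fin N) : EuclideanSpace ℝ (Fin d) :=
  limUnder atTop (fun n : ℕ => Φ.wordMap (fun i : Fin n => ω i) 0)

/-! ### Facts needed to see that the objects below are well defined -/

theorem two_le_q (a : Fin N) : (2 : ℝ) ≤ |(Φ.q a : ℝ)| := by
  have h := Φ.two_le_abs_q a
  have : ((2 : ℤ) : ℝ) ≤ ((|Φ.q a| : ℤ) : ℝ) := by exact_mod_cast h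
  simpa using this

theorem ratio_pos (a : Fin N) : 0 < Φ.ratio a :=
  inv_pos.2 (lt_of_lt_of_le two_pos (Φ.two_le_q a))

theorem ratio_le (a : Fin N) : Φ.ratio a ≤ 1 / 2 := by
  have := inv_anti₀ two_pos (Φ.two_le_q a)
  simpa [ratio] using this

theorem dist_map (a : Fin N) (x y : EuclideanSpace ℝ (Fin d)) :
    dist (Φ.map a x) (Φ.map a y) = Φ.ratio a * dist x y := by
  simp [map, ratio, dist_smul₀, dist_add_right]

theorem continuous_map (a : Fin N) : Continuous (Φ.map a) := by
  unfold map; fun_prop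

theorem wordMap_zero (a : Fin 0 → Fin N) : Φ.wordMap a = id := by
  simp [wordMap]

theorem wordMap_succ {n : ℕ} (ω : ℕ → Fin N) :
    Φ.wordMap (fun i : Fin (n + 1) => ω i)
      = Φ.map (ω 0) ∘ Φ.wordMap (fun i : Fin n => ω (i + 1)) := by
  simp [wordMap, List.ofFn_succ]

theorem dist_wordMap_le (n : ℕ) (ω : ℕ → Fin N) (x y : EuclideanSpace ℝ (Fin d)) :
    dist (Φ.wordMap (fun i : Fin n => ω i) x) (Φ.wordMap (fun i : Fin n => ω i) y)
      ≤ (1 / 2) ^ n * dist x y := by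
  induction n generalizing ω with
  | zero => simp [wordMap_zero]
  | succ n ih =>
    rw [wordMap_succ, Function.comp_apply, Function.comp_apply, dist_map, pow_succ']
    have h1 := ih (fun k => ω (k + 1))
    have h2 := Φ.ratio_le (ω 0)
    have h3 := (Φ.ratio_pos (ω 0)).le
    calc _ ≤ 1 / 2 * ((1 / 2) ^ n * dist x y) := by gcongr
      _ = _ := by ring

theorem wordMap_succ_last (n : ℕ) (ω : ℕ → Fin N) (x : EuclideanSpace ℝ (Fin d)) :
    Φ.wordMap (fun i : Fin (n + 1) => ω i) x
      = Φ.wordMap (fun i : Fin n => ω i) (Φ.map (ω n) x) := by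
  induction n generalizing ω with
  | zero => rw [wordMap_succ, wordMap_zero, wordMap_zero]; rfl
  | succ n ih =>
    rw [wordMap_succ, Function.comp_apply, ih (fun k => ω (k + 1)), wordMap_succ,
      Function.comp_apply]

theorem tendsto_coding (ω : ℕ → Fin N) :
    Tendsto (fun n : ℕ => Φ.wordMap (fun i : Fin n => ω i) 0) atTop (𝓝 (Φ.coding ω)) := by
  refine CauchySeq.tendsto_limUnder ?_
  refine cauchySeq_of_le_geometric (1 / 2) (∑ a, dist 0 (Φ.map a 0)) (by norm_num) fun n => ?_
  rw [wordMap_succ_last]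
  refine (Φ.dist_wordMap_le n ω _ _).trans ?_
  rw [mul_comm]
  gcongr
  exact Finset.single_le_sum (f := fun a => dist 0 (Φ.map a 0)) (fun _ _ => dist_nonneg)
    (Finset.mem_univ (ω n))

theorem dist_coding_le (n : ℕ) (ω : ℕ → Fin N) :
    dist (Φ.wordMap (fun i : Fin n => ω i) 0) (Φ.coding ω)
      ≤ (∑ a, dist 0 (Φ.map a 0)) * (1 / 2) ^ n / (1 - 1 / 2) := by
  refine dist_le_of_le_geometric_of_tendsto (1 / 2) (∑ a, dist 0 (Φ.map a 0)) (by norm_num)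
    (fun n => ?_) (Φ.tendsto_coding ω) n
  rw [wordMap_succ_last]
  refine (Φ.dist_wordMap_le n ω _ _).trans ?_
  rw [mul_comm]
  gcongr
  exact Finset.single_le_sum (f := fun a => dist 0 (Φ.map a 0)) (fun _ _ => dist_nonneg)
    (Finset.mem_univ (ω n))

theorem tendsto_coding_of_bounded (ω : ℕ → Fin N) (y : ℕ → EuclideanSpace ℝ (Fin d)) (C : ℝ)
    (hy : ∀ n, dist (y n) 0 ≤ C) :
    Tendsto (fun n : ℕ => Φ.wordMap (fun i : Fin n => ω i) (y n)) atTop (𝓝 (Φ.coding ω)) := by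
  refine (Φ.tendsto_coding ω).congr_dist ?_
  have h0 : Tendsto (fun n : ℕ => ((1 : ℝ) / 2) ^ n * C) atTop (𝓝 0) := by
    simpa using (tendsto_pow_atTop_nhds_zero_of_lt_one (by norm_num : (0 : ℝ) ≤ 1 / 2)
      (by norm_num)).mul_const C
  refine squeeze_zero (fun _ => dist_nonneg) (fun n => ?_) h0
  refine (Φ.dist_wordMap_le n ω _ _).trans ?_
  rw [dist_comm]
  gcongr
  exact hy n

theorem coding_eq (ω : ℕ → Fin N) :
    Φ.coding ω = Φ.map (ω 0) (Φ.coding fun k => ω (k + 1)) := by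
  have h1 := (tendsto_add_atTop_iff_nat 1).2 (Φ.tendsto_coding ω)
  have h2 := ((Φ.continuous_map (ω 0)).tendsto _).comp (Φ.tendsto_coding fun k => ω (k + 1))
  refine tendsto_nhds_unique h1 (h2.congr fun n => ?_)
  rw [wordMap_succ]; rfl

theorem continuous_wordMap_zero (n : ℕ) :
    Continuous fun ω : ℕ → Fin N => Φ.wordMap (fun i : Fin n => ω i) 0 := by
  have h : Continuous fun ω : ℕ → Fin N => (fun i : Fin n => ω i) := by fun_prop
  have h' : Continuous fun a : Fin n → Fin N => Φ.wordMap a 0 := continuous_of_discreteTopology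
  exact h'.comp h

theorem continuous_coding : Continuous Φ.coding := by
  have h : TendstoUniformly (fun (n : ℕ) (ω : ℕ → Fin N) => Φ.wordMap (fun i : Fin n => ω i) 0)
      Φ.coding atTop := by
    rw [Metric.tendstoUniformly_iff]
    intro ε hε
    have h0 : Tendsto (fun n : ℕ => (∑ a, dist 0 (Φ.map a 0)) * (1 / 2) ^ n / (1 - 1 / 2)) atTop
        (𝓝 0) := by
      simpa using ((tendsto_pow_atTop_nhds_zero_of_lt_one (by norm_num : (0 : ℝ) ≤ 1 / 2)
        (by norm_num)).const_mul (∑ a, dist 0 (Φ.map a 0))).div_const (1 - 1 / 2 : ℝ)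
    filter_upwards [h0.eventually (gt_mem_nhds hε)] with n hn ω
    rw [dist_comm]
    exact (Φ.dist_coding_le n ω).trans_lt hn
  exact h.continuous (Frequently.of_forall fun n => Φ.continuous_wordMap_zero n)

theorem wordMap_mem {Y : Set (EuclideanSpace ℝ (Fin d))} (hY : Y = ⋃ a, Φ.map a '' Y) (n : ℕ)
    (ω : ℕ → Fin N) {y : EuclideanSpace ℝ (Fin d)} (hy : y ∈ Y) :
    Φ.wordMap (fun i : Fin n => ω i) y ∈ Y := by
  induction n generalizing ω with
  | zero => simpa [wordMap_zero] using hy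
  | succ n ih =>
    rw [wordMap_succ, hY]
    exact Set.mem_iUnion.2 ⟨ω 0, _, ih (fun k => ω (k + 1)), rfl⟩

theorem range_coding_eq : Set.range Φ.coding = ⋃ a, Φ.map a '' Set.range Φ.coding := by
  ext x
  simp only [Set.mem_range, Set.mem_iUnion, Set.mem_image, exists_exists_eq_and]
  constructor
  · rintro ⟨ω, rfl⟩
    exact ⟨ω 0, fun k => ω (k + 1), (Φ.coding_eq ω).symm⟩
  · rintro ⟨a, ω, rfl⟩
    exact ⟨fun k => Nat.casesOn k a ω, Φ.coding_eq _⟩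

theorem eq_range_coding {Y : Set (EuclideanSpace ℝ (Fin d))} (hne : Y.Nonempty)
    (hc : IsCompact Y) (hY : Y = ⋃ a, Φ.map a '' Y) : Y = Set.range Φ.coding := by
  obtain ⟨C, hC⟩ := hc.isBounded.subset_closedBall 0
  apply Set.Subset.antisymm
  · intro y hy
    have key : ∀ z : Y, ∃ a : Fin N, ∃ w : Y, Φ.map a w = z := by
      rintro ⟨z, hz⟩
      rw [hY] at hz
      obtain ⟨a, w, hw, rfl⟩ := Set.mem_iUnion.1 hz
      exact ⟨a, ⟨w, hw⟩, rfl⟩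
    choose a T hT using key
    let z : ℕ → Y := fun n => T^[n] ⟨y, hy⟩
    have hz : ∀ n, Φ.wordMap (fun i : Fin n => a (z i)) (z n) = y := by
      intro n
      induction n with
      | zero => simp [wordMap_zero, z]
      | succ n ih =>
        rw [Φ.wordMap_succ_last n (fun k => a (z k))]
        have : (z (n + 1)) = T (z n) := Function.iterate_succ_apply' T n _
        rw [this, hT, ih]
    refine ⟨fun k => a (z k), ?_⟩
    have h := Φ.tendsto_coding_of_bounded (fun k => a (z k)) (fun n => z n) C
      (fun n => hC (z n).2)
    simp only [hz] at h
    exact tendsto_nhds_unique h tendsto_const_nhds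
  · rintro _ ⟨ω, rfl⟩
    obtain ⟨y, hy⟩ := hne
    exact hc.isClosed.mem_of_tendsto
      (Φ.tendsto_coding_of_bounded ω (fun _ => y) C (fun _ => hC hy))
      (Eventually.of_forall fun n => Φ.wordMap_mem hY n ω hy)

/-- There is a unique non-empty compact set `X` with `X = ⋃ a, φ_a(X)`. -/
theorem existsUnique_selfSimilarSet [NeZero N] :
    ∃! X : Set (EuclideanSpace ℝ (Fin d)), X.Nonempty ∧ IsCompact X ∧ X = ⋃ a, Φ.map a '' X :=
  ⟨Set.range Φ.coding, ⟨Set.range_nonempty _, isCompact_range Φ.continuous_coding,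
    Φ.range_coding_eq⟩, fun _ h => Φ.eq_range_coding h.1 h.2.1 h.2.2⟩

/-- The equation `∑ a, r_a ^ s = 1` has a unique solution. -/
theorem existsUnique_simDim [NeZero N] : ∃! s : ℝ, ∑ a, Φ.ratio a ^ s = 1 := by
  have hN : 1 ≤ N := Nat.one_le_iff_ne_zero.2 (NeZero.ne N)
  have hanti : StrictAnti fun s : ℝ => ∑ a, Φ.ratio a ^ s := by
    intro s t hst
    refine Finset.sum_lt_sum_of_nonempty ⟨⟨0, hN⟩, Finset.mem_univ _⟩ fun a _ => ?_
    exact Real.rpow_lt_rpow_of_exponent_gt (Φ.ratio_pos a)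
      ((Φ.ratio_le a).trans_lt (by norm_num)) hst
  have hcont : Continuous fun s : ℝ => ∑ a, Φ.ratio a ^ s :=
    continuous_finsetSum _ fun a _ =>
      Real.continuous_const_rpow (Φ.ratio_pos a).ne'
  have hlim : Tendsto (fun s : ℝ => ∑ a, Φ.ratio a ^ s) atTop (𝓝 0) := by
    simpa using tendsto_finsetSum (Finset.univ : Finset (Fin N)) fun a _ =>
      tendsto_rpow_atTop_of_base_lt_one (Φ.ratio a) (by linarith [Φ.ratio_pos a])
        ((Φ.ratio_le a).trans_lt (by norm_num))
  obtain ⟨t, ht0, ht⟩ := ((eventually_ge_atTop (0 : ℝ)).and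
    (hlim.eventually (gt_mem_nhds one_pos))).exists
  have h0 : (1 : ℝ) ≤ ∑ a, Φ.ratio a ^ (0 : ℝ) := by simpa using hN
  obtain ⟨s, -, hs⟩ := intermediate_value_Icc' ht0 hcont.continuousOn
    (show (1 : ℝ) ∈ Set.Icc _ _ from ⟨ht.le, h0⟩)
  exact ⟨s, hs, fun u hu => hanti.injective (hu.trans hs.symm)⟩

/-- The self-similar set `X` of `Φ`. -/
def selfSimilarSet [NeZero N] : Set (EuclideanSpace ℝ (Fin d)) :=
  Φ.existsUnique_selfSimilarSet.choose

/-- The similarity dimension of `Φ`. -/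
def simDim [NeZero N] : ℝ := Φ.existsUnique_simDim.choose

/-- The probability vector `p_a = r_a ^ (dim_S Φ)`. -/
def weight [NeZero N] (a : Fin N) : ℝ := Φ.ratio a ^ Φ.simDim

theorem selfSimilarSet_eq_range [NeZero N] : Φ.selfSimilarSet = Set.range Φ.coding := by
  have h := Φ.existsUnique_selfSimilarSet.choose_spec.1
  exact Φ.eq_range_coding h.1 h.2.1 h.2.2

theorem sum_weight [NeZero N] : ∑ a, Φ.weight a = 1 := Φ.existsUnique_simDim.choose_spec.1

theorem weight_pos [NeZero N] (a : Fin N) : 0 < Φ.weight a :=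
  Real.rpow_pos_of_pos (Φ.ratio_pos a) _

/-- The Bernoulli measure on `ℕ → Fin N` with weights `p_a`. -/
def bernoulli [NeZero N] : Measure (ℕ → Fin N) :=
  Measure.infinitePi fun _ : ℕ => ∑ a, ENNReal.ofReal (Φ.weight a) • Measure.dirac a

theorem sum_ofReal_weight [NeZero N] : ∑ a, ENNReal.ofReal (Φ.weight a) = 1 := by
  rw [← ENNReal.ofReal_sum_of_nonneg fun a _ => (Φ.weight_pos a).le, sum_weight,
    ENNReal.ofReal_one]

instance isProbabilityMeasure_letter [NeZero N] : IsProbabilityMeasure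
    (∑ a, ENNReal.ofReal (Φ.weight a) • Measure.dirac a : Measure (Fin N)) :=
  ⟨by simp [Measure.finsetSum_apply, sum_ofReal_weight]⟩

instance isProbabilityMeasure_bernoulli [NeZero N] : IsProbabilityMeasure Φ.bernoulli := by
  unfold bernoulli; infer_instance

theorem measurable_cons (a : Fin N) :
    Measurable fun (ω : ℕ → Fin N) (k : ℕ) => (Nat.casesOn k a ω : Fin N) := by
  refine measurable_pi_iff.2 fun k => ?_
  cases k with
  | zero => exact measurable_const
  | succ k => exact measurable_pi_apply k

theorem bernoulli_eq [NeZero N] : Φ.bernoulli = ∑ a, ENNReal.ofReal (Φ.weight a) •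
    Φ.bernoulli.map (fun (ω : ℕ → Fin N) (k : ℕ) => (Nat.casesOn k a ω : Fin N)) := by
  symm
  unfold bernoulli
  apply Measure.eq_infinitePi
  intro s t ht
  classical
  obtain ⟨n, hn⟩ : ∃ n, s ⊆ Finset.range (n + 1) :=
    ⟨s.sup id, fun i hi => Finset.mem_range.2 (Nat.lt_succ_of_le (Finset.le_sup (f := id) hi))⟩
  let u : ℕ → Set (Fin N) := fun i => if i ∈ s then t i else Set.univ
  have hu : ∀ i, MeasurableSet (u i) := fun i => MeasurableSet.of_discrete
  have h1 : Set.pi (s : Set ℕ) t = Set.pi (Finset.range (n + 1) : Set ℕ) u := by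
    ext ω
    simp only [Set.mem_pi, Finset.mem_coe, u]
    constructor
    · intro h i _
      split_ifs with hi
      · exact h i hi
      · trivial
    · intro h i hi
      simpa [hi] using h i (hn hi)
  have h2 : ∏ i ∈ s, (∑ a, ENNReal.ofReal (Φ.weight a) • Measure.dirac a : Measure (Fin N)) (t i)
      = ∏ i ∈ Finset.range (n + 1),
        (∑ a, ENNReal.ofReal (Φ.weight a) • Measure.dirac a : Measure (Fin N)) (u i) := by
    rw [← Finset.prod_subset hn (fun i _ hi => by simp only [u, hi, if_false, measure_univ])]
    exact Finset.prod_congr rfl fun i hi => by simp only [u, hi, if_true]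
  have h3 : ∀ a : Fin N,
      (fun (ω : ℕ → Fin N) (k : ℕ) => (Nat.casesOn k a ω : Fin N)) ⁻¹'
        (Set.pi (Finset.range (n + 1) : Set ℕ) u)
      = if a ∈ u 0 then Set.pi (Finset.range n : Set ℕ) (fun i => u (i + 1)) else ∅ := by
    intro a
    ext ω
    simp only [Set.mem_preimage, Set.mem_pi, Finset.mem_coe, Finset.mem_range]
    split_ifs with ha
    · simp only [Set.mem_pi, Finset.mem_coe, Finset.mem_range]
      constructor
      · intro h i hi
        exact h (i + 1) (by omega)
      · intro h i hi
        cases i with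
        | zero => exact ha
        | succ i => exact h i (by omega)
    · simp only [Set.mem_empty_iff_false, iff_false]
      intro h
      exact ha (h 0 (by omega))
  have hm : MeasurableSet (Set.pi (Finset.range (n + 1) : Set ℕ) u) :=
    MeasurableSet.pi (Finset.countable_toSet _) fun i _ => hu i
  rw [h2, h1, Finset.prod_range_succ', Measure.finsetSum_apply]
  have h4 : ∀ a : Fin N, (ENNReal.ofReal (Φ.weight a) •
      (Measure.infinitePi fun _ : ℕ =>
        (∑ a, ENNReal.ofReal (Φ.weight a) • Measure.dirac a : Measure (Fin N))).map
        (fun (ω : ℕ → Fin N) (k : ℕ) => (Nat.casesOn k a ω : Fin N)))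
        (Set.pi (Finset.range (n + 1) : Set ℕ) u)
      = (∏ i ∈ Finset.range n,
        (∑ a, ENNReal.ofReal (Φ.weight a) • Measure.dirac a : Measure (Fin N)) (u (i + 1)))
        * (ENNReal.ofReal (Φ.weight a) * Measure.dirac a (u 0)) := by
    intro a
    rw [Measure.smul_apply, Measure.map_apply (measurable_cons a) hm, h3, smul_eq_mul]
    by_cases ha : a ∈ u 0
    · rw [if_pos ha, Measure.infinitePi_pi _ (fun i _ => hu _), Measure.dirac_apply_of_mem ha]
      ring
    · rw [if_neg ha, measure_empty, Measure.dirac_apply' _ (hu 0)]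
      simp [ha]
  rw [Finset.sum_congr rfl fun a _ => h4 a, ← Finset.mul_sum, Measure.finsetSum_apply]
  simp only [Measure.smul_apply, smul_eq_mul]

theorem measurable_coding : Measurable Φ.coding := Φ.continuous_coding.measurable

theorem coding_cons (a : Fin N) (ω : ℕ → Fin N) :
    Φ.coding (fun k => Nat.casesOn k a ω) = Φ.map a (Φ.coding ω) := Φ.coding_eq _

theorem map_coding_bernoulli_eq [NeZero N] : Φ.bernoulli.map Φ.coding =
    ∑ a, ENNReal.ofReal (Φ.weight a) • (Φ.bernoulli.map Φ.coding).map (Φ.map a) := by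
  ext S hS
  rw [Measure.map_apply Φ.measurable_coding hS, Φ.bernoulli_eq]
  simp only [Measure.finsetSum_apply, Measure.smul_apply]
  refine Finset.sum_congr rfl fun a _ => ?_
  rw [← Φ.bernoulli_eq, Measure.map_apply (measurable_cons a) (Φ.measurable_coding hS),
    Measure.map_apply (Φ.continuous_map a).measurable hS,
    Measure.map_apply Φ.measurable_coding ((Φ.continuous_map a).measurable hS)]
  congr 2
  ext ω
  exact iff_of_eq (congrArg (· ∈ S) (Φ.coding_cons a ω))

theorem measurable_wordMap (n : ℕ) : Measurable
    fun z : (ℕ → Fin N) × EuclideanSpace ℝ (Fin d) => Φ.wordMap (fun i : Fin n => z.1 i) z.2 := by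
  have h : Measurable fun z : (Fin n → Fin N) × EuclideanSpace ℝ (Fin d) =>
      Φ.wordMap z.1 z.2 := by
    refine measurable_from_prod_countable_right fun a => ?_
    have : Continuous (Φ.wordMap a) := by
      unfold wordMap
      induction List.ofFn a with
      | nil => exact continuous_id
      | cons b l ih => exact (Φ.continuous_map b).comp ih
    exact this.measurable
  have h' : Measurable fun z : (ℕ → Fin N) × EuclideanSpace ℝ (Fin d) =>
      ((fun i : Fin n => z.1 i, z.2) : (Fin n → Fin N) × EuclideanSpace ℝ (Fin d)) := by
    fun_prop
  exact h.comp h'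

theorem lintegral_wordMap [NeZero N] {ν : Measure (EuclideanSpace ℝ (Fin d))}
    [IsProbabilityMeasure ν]
    (hν : ν = ∑ a, ENNReal.ofReal (Φ.weight a) • ν.map (Φ.map a)) (n : ℕ)
    {f : EuclideanSpace ℝ (Fin d) → ENNReal} (hf : Measurable f) :
    ∫⁻ ω, ∫⁻ x, f (Φ.wordMap (fun i : Fin n => ω i) x) ∂ν ∂Φ.bernoulli = ∫⁻ x, f x ∂ν := by
  induction n generalizing f with
  | zero => simp [wordMap_zero]
  | succ n ih =>
    have hF : Measurable fun ω : ℕ → Fin N =>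
        ∫⁻ x, f (Φ.wordMap (fun i : Fin (n + 1) => ω i) x) ∂ν :=
      Measurable.lintegral_prod_right' (hf.comp (Φ.measurable_wordMap (n + 1)))
    have e1 := congrArg (fun m : Measure (ℕ → Fin N) =>
      ∫⁻ ω, ∫⁻ x, f (Φ.wordMap (fun i : Fin (n + 1) => ω i) x) ∂ν ∂m) Φ.bernoulli_eq
    have e2 := congrArg (fun m : Measure (EuclideanSpace ℝ (Fin d)) => ∫⁻ x, f x ∂m) hν
    simp only [lintegral_finsetSum_measure, lintegral_smul_measure] at e1 e2
    rw [e1, e2]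
    refine Finset.sum_congr rfl fun a _ => ?_
    rw [lintegral_map hF (measurable_cons a), lintegral_map hf (Φ.continuous_map a).measurable,
      ← show _ = ∫⁻ x, f (Φ.map a x) ∂ν from ih (hf.comp (Φ.continuous_map a).measurable)]
    congr 1
    refine lintegral_congr fun ω => lintegral_congr fun x => ?_
    rw [Φ.wordMap_succ (fun k => Nat.casesOn k a ω)]
    rfl

theorem eq_map_coding [NeZero N] {ν : Measure (EuclideanSpace ℝ (Fin d))}
    [IsProbabilityMeasure ν]
    (hν : ν = ∑ a, ENNReal.ofReal (Φ.weight a) • ν.map (Φ.map a)) :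
    ν = Φ.bernoulli.map Φ.coding := by
  have : IsProbabilityMeasure (Φ.bernoulli.map Φ.coding) :=
    Measure.isProbabilityMeasure_map Φ.measurable_coding.aemeasurable
  refine ext_of_forall_lintegral_eq_of_IsFiniteMeasure fun f => ?_
  have hf : Measurable fun x => (f x : ENNReal) := by fun_prop
  have h1 : ∀ n : ℕ, ∫⁻ z, f (Φ.wordMap (fun i : Fin n => z.1 i) z.2) ∂(Φ.bernoulli.prod ν)
      = ∫⁻ x, f x ∂ν := by
    intro n
    rw [← Φ.lintegral_wordMap hν n hf]
    exact lintegral_prod _ (hf.comp (Φ.measurable_wordMap n)).aemeasurable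
  have h2 : Tendsto (fun n : ℕ =>
      ∫⁻ z, f (Φ.wordMap (fun i : Fin n => z.1 i) z.2) ∂(Φ.bernoulli.prod ν)) atTop
      (𝓝 (∫⁻ z, f (Φ.coding z.1) ∂(Φ.bernoulli.prod ν))) := by
    refine tendsto_lintegral_of_dominated_convergence (fun _ => ((nndist f 0 : NNReal) : ENNReal))
      (fun n => hf.comp (Φ.measurable_wordMap n)) (fun n => Eventually.of_forall fun z => ?_)
      (by simp) (Eventually.of_forall fun z => ?_)
    · have := BoundedContinuousFunction.NNReal.upper_bound f
        (Φ.wordMap (fun i : Fin n => z.1 i) z.2)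
      exact ENNReal.coe_le_coe.2 this
    · have h := Φ.tendsto_coding_of_bounded z.1 (fun _ => z.2) (dist z.2 0) fun _ => le_rfl
      exact (ENNReal.continuous_coe.tendsto _).comp ((f.continuous.tendsto _).comp h)
  simp only [h1] at h2
  rw [tendsto_nhds_unique tendsto_const_nhds h2, lintegral_map hf Φ.measurable_coding,
    lintegral_prod _ (by
      exact (hf.comp (Φ.measurable_coding.comp measurable_fst)).aemeasurable)]
  simp

/-- There is a unique Borel probability measure `μ` with `μ = ∑ a, p_a • (φ_a)_* μ`, where
`p_a = r_a ^ (dim_S Φ)`. -/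
theorem existsUnique_selfSimilarMeasure [NeZero N] :
    ∃! μ : Measure (EuclideanSpace ℝ (Fin d)), IsProbabilityMeasure μ ∧
      μ = ∑ a, ENNReal.ofReal (Φ.weight a) • μ.map (Φ.map a) :=
  ⟨Φ.bernoulli.map Φ.coding,
    ⟨Measure.isProbabilityMeasure_map Φ.measurable_coding.aemeasurable,
      Φ.map_coding_bernoulli_eq⟩,
    fun _ h => have := h.1; Φ.eq_map_coding h.2⟩

/-- The self-similar measure `μ` of `Φ` corresponding to the weights `p_a = r_a ^ (dim_S Φ)`. -/
def selfSimilarMeasure [NeZero N] : Measure (EuclideanSpace ℝ (Fin d)) :=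
  Φ.existsUnique_selfSimilarMeasure.choose

/-- The self-similar measure is the image of the Bernoulli measure under the coding map. -/
theorem selfSimilarMeasure_eq_map [NeZero N] :
    Φ.selfSimilarMeasure = Φ.bernoulli.map Φ.coding :=
  have h := Φ.existsUnique_selfSimilarMeasure.choose_spec.1
  have : IsProbabilityMeasure Φ.selfSimilarMeasure := h.1
  Φ.eq_map_coding h.2

/-! ### The notions of the theorem -/

/-- The strong separation condition: the sets `φ_a(X)` are pairwise disjoint. -/
def StrongSeparation [NeZero N] : Prop :=
  ∀ a b : Fin N, a ≠ b → Disjoint (Φ.map a '' Φ.selfSimilarSet) (Φ.map b '' Φ.selfSimilarSet)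

/-- The entropy `h_p = -∑ a, p_a log p_a`. -/
def entropy [NeZero N] : ℝ := -∑ a, Φ.weight a * Real.log (Φ.weight a)

/-- The cylinder `X_a = φ_a(X)` of a finite word `a`. -/
def cylinder [NeZero N] {n : ℕ} (a : Fin n → Fin N) : Set (EuclideanSpace ℝ (Fin d)) :=
  Φ.wordMap a '' Φ.selfSimilarSet

/-- For a word `a` of length `n` and `0 ≤ l ≤ n - 1`, the sequence
`a_1 … a_l (a_{l+1} … a_n)^∞`. -/
def eventuallyPeriodic {n : ℕ} (a : Fin n → Fin N) (l : Fin n) (k : ℕ) : Fin N :=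
  if h : k < l then a ⟨k, h.trans l.2⟩
  else a ⟨l + (k - l) % (n - l), by
    have h1 := l.2
    have h2 := Nat.mod_lt (k - l) (Nat.sub_pos_of_lt h1)
    omega⟩

/-- For a rational point `y ∈ X`, the least length `n` of a word `a` such that
`y = π(a_1 … a_l (a_{l+1} … a_n)^∞)` for some `0 ≤ l ≤ n - 1`. -/
def minLength (y : EuclideanSpace ℝ (Fin d)) : ℕ :=
  sInf {n : ℕ | ∃ (a : Fin n → Fin N) (l : Fin n), Φ.coding (eventuallyPeriodic a l) = y}

/-- The point `p / q` of `ℝ^d`. -/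
def ratPoint {d : ℕ} (p : Fin d → ℤ) (q : ℕ) : EuclideanSpace ℝ (Fin d) :=
  WithLp.toLp 2 fun i => (p i : ℝ) / q

/-- The pair `(p, q)` represents a rational point `p / q` in reduced form: `q ≥ 1` and
`gcd(p_1, …, p_d, q) = 1`. -/
def IsReducedForm {d : ℕ} (p : Fin d → ℤ) (q : ℕ) : Prop :=
  0 < q ∧ ∀ k : ℕ, k ∣ q → (∀ i, (k : ℤ) ∣ p i) → k = 1

/-- The set of `x ∈ X` such that `‖x - p/q‖ < g(n(p/q)) / q` for infinitely many rational points
`p/q ∈ X`, written in reduced form. -/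
def approximable [NeZero N] (g : ℕ → NNReal) :
    Set (EuclideanSpace ℝ (Fin d)) :=
  {x | x ∈ Φ.selfSimilarSet ∧
    {pq : (Fin d → ℤ) × ℕ | IsReducedForm pq.1 pq.2 ∧ ratPoint pq.1 pq.2 ∈ Φ.selfSimilarSet ∧
      ‖x - ratPoint pq.1 pq.2‖ < g (Φ.minLength (ratPoint pq.1 pq.2)) / pq.2}.Infinite}

end

end RationalIFS

/-!
The theorem is proved on the space of sequences `ω` of letters with the Bernoulli measure, of which
the self-similar measure is the image under the coding map `π`.

*Reduction to repetitions.* Suppose that the letters `ω_{n+1}, ω_{n+2}, …` repeat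
`ω_{l+1}, ω_{l+2}, …` (`l < n`) along a word `w` of length `m`. Then `ω` agrees for `n + m` letters
with the eventually periodic sequence `ω_1 … ω_l (ω_{l+1} … ω_n)^∞`, so `π(ω)` is within
`diam X · r_{ω_1 … ω_n} · r_w` of the coding `y` of that sequence (`dist_coding_le_of_eq`). The
point `y` is rational with a denominator at most `(3/2) / r_{ω_1 … ω_n}`
(`exists_isReducedForm_coding`), and its minimal length is at most `n`. Since `p_w = r_w ^ s` with
`s = dim_S Φ`, it suffices that `p_w` is at most a constant times `g(n) ^ s`
(`exists_near_of_mem_blockEvent`). Strong separation makes `π` injective, so almost no `π(ω)` is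
rational and infinitely many repetitions give infinitely many rational points.

*Counting.* As `∑ r_a ^ s = 1` over the words `a` of each length, the hypothesis on `g` says that
`∑ n g(n) ^ s = ∞`, and condensation in base `5` gives `∑ M ^ 2 g(5 M) ^ s = ∞` over the powers
`M = 5 ^ j`. Compare the positions in `[M, 2M)` with those in `[3M, 4M)`: there are `M ^ 2` pairs,
and each yields a repetition of weight at most `ψ` with probability between a constant times `ψ`
and `ψ`. For two pairs, `lintegral_agree_agree_le` bounds the probability that both yield one by
`2 ψ ^ 2`, except when the pairs differ by the same shift `j` in both coordinates, where an
additional term `ψ ρ ^ j` with `ρ < 1` appears. This rests on `lintegral_agree_shift_le`: a sequence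
agrees with its own shift on a word of weight at most `θ` with probability at most `θ`, even if the
two copies of the word overlap. By the second moment method a repetition occurs in the block with
probability at least a constant times `min (M ^ 2 ψ) 1` (`le_bernoulli_blockEvent`). These events
depend on the disjoint sets of letters `[M, 5M)`, hence are independent, and the second
Borel–Cantelli lemma applies.

Measuring words by their weight rather than by their length makes these estimates independent of the
entropy; the entropy hypothesis only serves to exclude an alphabet with a single letter.
-/

namespace RationalIFS

noncomputable section

section Words

/-! ### Sequences of letters: shifts, prefixes and agreement -/

variable {d N : ℕ}

/-- The sequence `ω_b, ω_{b+1}, …`, written `T^b ω` in the comments below. -/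
def shift (b : ℕ) (ω : ℕ → Fin N) : ℕ → Fin N := fun k => ω (b + k)

/-- The first `b` letters of `ω`, followed by the sequence `η`. -/
def splice (b : ℕ) (ω η : ℕ → Fin N) : ℕ → Fin N := fun k => if k < b then ω k else η (k - b)

theorem splice_of_lt {b k : ℕ} (h : k < b) (ω η : ℕ → Fin N) : splice b ω η k = ω k := if_pos h

theorem splice_add (b k : ℕ) (ω η : ℕ → Fin N) : splice b ω η (b + k) = η k := by
  simp [splice]

theorem shift_splice (b : ℕ) (ω η : ℕ → Fin N) : shift b (splice b ω η) = η :=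
  funext fun k => splice_add b k ω η

theorem shift_shift (a b : ℕ) (ω : ℕ → Fin N) : shift a (shift b ω) = shift (b + a) ω :=
  funext fun k => by simp only [shift, add_assoc]

theorem shift_zero (ω : ℕ → Fin N) : shift 0 ω = ω := funext fun k => by simp [shift]

theorem measurable_shift (b : ℕ) : Measurable (shift b : (ℕ → Fin N) → ℕ → Fin N) :=
  measurable_pi_iff.2 fun k => measurable_pi_apply (b + k)

theorem measurable_splice (b : ℕ) :
    Measurable fun z : (ℕ → Fin N) × (ℕ → Fin N) => splice b z.1 z.2 := by
  refine measurable_pi_iff.2 fun k => ?_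
  unfold splice
  split_ifs <;> fun_prop

theorem measurableSet_eqOn (ω : ℕ → Fin N) (n : ℕ) :
    MeasurableSet {η : ℕ → Fin N | ∀ i < n, ω i = η i} := by
  simp only [Set.ofPred_forall]
  exact MeasurableSet.iInter fun i => MeasurableSet.iInter fun _ =>
    measurableSet_eq_fun measurable_const (measurable_pi_apply i)

variable [NeZero N] (Φ : RationalIFS d N)

/-- The Bernoulli measure of the cylinder of all sequences that start with the first `n` letters
of `ω`. -/
def prefixWeight (ω : ℕ → Fin N) (n : ℕ) : ENNReal :=
  ∏ i ∈ Finset.range n, ENNReal.ofReal (Φ.weight (ω i))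

/-- `ω` and `η` agree on a prefix of weight at most `θ`; that is, `η` lies in the cylinder of the
shortest prefix of `ω` whose weight does not exceed `θ`. -/
def Agree (θ : ENNReal) (ω η : ℕ → Fin N) : Prop :=
  ∃ n, Φ.prefixWeight ω n ≤ θ ∧ ∀ i < n, ω i = η i

theorem prefixWeight_congr {n : ℕ} {ω η : ℕ → Fin N} (h : ∀ i < n, ω i = η i) :
    Φ.prefixWeight ω n = Φ.prefixWeight η n :=
  Finset.prod_congr rfl fun i hi => by rw [h i (Finset.mem_range.1 hi)]

theorem ofReal_weight_pos (a : Fin N) : 0 < ENNReal.ofReal (Φ.weight a) :=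
  ENNReal.ofReal_pos.2 (Φ.weight_pos a)

theorem ofReal_weight_le_one (a : Fin N) : ENNReal.ofReal (Φ.weight a) ≤ 1 := by
  rw [← Φ.sum_ofReal_weight]
  exact Finset.single_le_sum (f := fun a => ENNReal.ofReal (Φ.weight a)) (fun _ _ => zero_le)
    (Finset.mem_univ a)

theorem prefixWeight_ne_zero (ω : ℕ → Fin N) (n : ℕ) : Φ.prefixWeight ω n ≠ 0 :=
  Finset.prod_ne_zero_iff.2 fun i _ => (Φ.ofReal_weight_pos (ω i)).ne'

theorem prefixWeight_le_one (ω : ℕ → Fin N) (n : ℕ) : Φ.prefixWeight ω n ≤ 1 :=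
  Finset.prod_le_one' fun i _ => Φ.ofReal_weight_le_one (ω i)

theorem prefixWeight_ne_top (ω : ℕ → Fin N) (n : ℕ) : Φ.prefixWeight ω n ≠ ⊤ :=
  ((Φ.prefixWeight_le_one ω n).trans_lt ENNReal.one_lt_top).ne

theorem prefixWeight_le_pow {ρ : ENNReal} (hρ : ∀ a, ENNReal.ofReal (Φ.weight a) ≤ ρ)
    (ω : ℕ → Fin N) (n : ℕ) : Φ.prefixWeight ω n ≤ ρ ^ n := by
  simpa [prefixWeight] using Finset.prod_le_pow_card (Finset.range n)
    (fun i => ENNReal.ofReal (Φ.weight (ω i))) ρ fun i _ => hρ (ω i)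

theorem prefixWeight_add (ω : ℕ → Fin N) (m n : ℕ) :
    Φ.prefixWeight ω (m + n) = Φ.prefixWeight ω m * Φ.prefixWeight (shift m ω) n :=
  Finset.prod_range_add _ _ _

theorem measurable_prefixWeight (n : ℕ) : Measurable fun ω => Φ.prefixWeight ω n := by
  unfold prefixWeight
  refine Finset.measurable_prod _ fun i _ => ?_
  exact (measurable_of_countable fun a => ENNReal.ofReal (Φ.weight a)).comp
    (measurable_pi_apply i)

theorem Agree.symm {θ : ENNReal} {ω η : ℕ → Fin N} (h : Φ.Agree θ ω η) : Φ.Agree θ η ω := by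
  obtain ⟨n, hn, he⟩ := h
  exact ⟨n, (Φ.prefixWeight_congr he) ▸ hn, fun i hi => (he i hi).symm⟩

theorem measurableSet_agree {Ω : Type*} [MeasurableSpace Ω] {θ : Ω → ENNReal}
    {f g : Ω → ℕ → Fin N} (hθ : Measurable θ) (hf : Measurable f) (hg : Measurable g) :
    MeasurableSet {x | Φ.Agree (θ x) (f x) (g x)} := by
  simp only [Agree, Set.ofPred_exists, Set.ofPred_and, Set.ofPred_forall]
  refine MeasurableSet.iUnion fun n => MeasurableSet.inter
    (measurableSet_le ((Φ.measurable_prefixWeight n).comp hf) hθ) ?_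
  exact MeasurableSet.iInter fun i => MeasurableSet.iInter fun _ =>
    measurableSet_eq_fun ((measurable_pi_apply i).comp hf) ((measurable_pi_apply i).comp hg)

/-! ### The Bernoulli measure of cylinders -/

/-- Resampling: under the Bernoulli measure the letters from position `b` on are independent of
the first `b` letters and are distributed like the whole sequence. -/
theorem lintegral_splice (b : ℕ) {F : (ℕ → Fin N) → ENNReal} (hF : Measurable F) :
    ∫⁻ ω, ∫⁻ η, F (splice b ω η) ∂Φ.bernoulli ∂Φ.bernoulli = ∫⁻ ω, F ω ∂Φ.bernoulli := by
  induction b generalizing F with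
  | zero =>
    have h : ∀ ω η : ℕ → Fin N, splice 0 ω η = η := fun ω η => funext fun k => by simp [splice]
    simp [h]
  | succ b ih =>
    have hG : Measurable fun ω => ∫⁻ η, F (splice (b + 1) ω η) ∂Φ.bernoulli :=
      Measurable.lintegral_prod_right' (hF.comp (measurable_splice (b + 1)))
    have e1 := congrArg (fun m : Measure (ℕ → Fin N) =>
      ∫⁻ ω, ∫⁻ η, F (splice (b + 1) ω η) ∂Φ.bernoulli ∂m) Φ.bernoulli_eq
    have e2 := congrArg (fun m : Measure (ℕ → Fin N) => ∫⁻ ω, F ω ∂m) Φ.bernoulli_eq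
    simp only [lintegral_finsetSum_measure, lintegral_smul_measure] at e1 e2
    rw [e1, e2]
    refine Finset.sum_congr rfl fun a _ => ?_
    rw [lintegral_map hG (measurable_cons a), lintegral_map hF (measurable_cons a),
      ← show _ = ∫⁻ ω, F (fun k => Nat.casesOn k a ω) ∂Φ.bernoulli from
        ih (hF.comp (measurable_cons a))]
    congr 1
    refine lintegral_congr fun ω => lintegral_congr fun η => ?_
    simp only
    congr 1
    funext k
    cases k <;> simp [splice]

theorem lintegral_shift (b : ℕ) {F : (ℕ → Fin N) → ENNReal} (hF : Measurable F) :
    ∫⁻ ω, F (shift b ω) ∂Φ.bernoulli = ∫⁻ ω, F ω ∂Φ.bernoulli := by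
  rw [← show _ = ∫⁻ ω, F (shift b ω) ∂Φ.bernoulli from
    Φ.lintegral_splice b (hF.comp (measurable_shift b))]
  simp [shift_splice]

theorem measure_splice (b : ℕ) {A : Set (ℕ → Fin N)} (hA : MeasurableSet A) :
    ∫⁻ ω, Φ.bernoulli {η | splice b ω η ∈ A} ∂Φ.bernoulli = Φ.bernoulli A := by
  rw [← lintegral_indicator_one hA, ← Φ.lintegral_splice b (measurable_one.indicator hA)]
  refine lintegral_congr fun ω => ?_
  have : Measurable (splice b ω) := (measurable_splice b).comp measurable_prodMk_left
  exact (lintegral_indicator_one (this hA)).symm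

theorem measure_shift (b : ℕ) {A : Set (ℕ → Fin N)} (hA : MeasurableSet A) :
    Φ.bernoulli {ω | shift b ω ∈ A} = Φ.bernoulli A := by
  rw [← show _ = Φ.bernoulli {ω | shift b ω ∈ A} from
    Φ.measure_splice b (measurable_shift b hA)]
  simp [shift_splice]

theorem bernoulli_cylinder (ω : ℕ → Fin N) (n : ℕ) :
    Φ.bernoulli {η | ∀ i < n, ω i = η i} = Φ.prefixWeight ω n := by
  have h : {η : ℕ → Fin N | ∀ i < n, ω i = η i}
      = Set.pi (Finset.range n : Set ℕ) fun i => {ω i} := by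
    ext η
    simp [Set.mem_pi, eq_comm]
  rw [h, bernoulli, Measure.infinitePi_pi _ fun i _ => measurableSet_singleton _]
  refine Finset.prod_congr rfl fun i _ => ?_
  rw [Measure.finsetSum_apply]
  simp [Set.indicator_apply]

/-- Events that depend on the first `b` letters are independent of events that depend only on
the later ones. -/
theorem bernoulli_inter (b : ℕ) {A B : Set (ℕ → Fin N)} (hA : MeasurableSet A)
    (hB : MeasurableSet B) (hAb : ∀ ω η, (∀ k < b, ω k = η k) → (ω ∈ A ↔ η ∈ A))
    (hBb : ∀ ω η, (∀ k, b ≤ k → ω k = η k) → (ω ∈ B ↔ η ∈ B)) :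
    Φ.bernoulli (A ∩ B) = Φ.bernoulli A * Φ.bernoulli B := by
  have hB' : ∀ ω, Φ.bernoulli {η | splice b ω η ∈ B} = Φ.bernoulli B := by
    have h : ∀ ω ω', {η | splice b ω η ∈ B} = {η | splice b ω' η ∈ B} := fun ω ω' =>
      Set.ext fun η => hBb _ _ fun k hk => by simp [splice, hk.not_gt]
    intro ω
    rw [← Φ.measure_splice b hB, lintegral_congr fun ω' => by rw [h ω' ω], lintegral_const,
      measure_univ, mul_one]
  rw [← Φ.measure_splice b (hA.inter hB)]
  have : ∀ ω, Φ.bernoulli {η | splice b ω η ∈ A ∩ B}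
      = A.indicator (fun _ => Φ.bernoulli B) ω := by
    intro ω
    have h : ∀ η, splice b ω η ∈ A ↔ ω ∈ A := fun η =>
      hAb _ _ fun k hk => splice_of_lt hk ω η
    by_cases hω : ω ∈ A
    · simp [Set.mem_inter_iff, h, hω, hB']
    · simp [Set.mem_inter_iff, h, hω]
  rw [lintegral_congr this, lintegral_indicator_const hA, mul_comm]

theorem bernoulli_agree_le (θ : ENNReal) (ω : ℕ → Fin N) :
    Φ.bernoulli {η | Φ.Agree θ ω η} ≤ θ := by
  classical
  by_cases h : ∃ n, Φ.prefixWeight ω n ≤ θ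
  · refine le_trans ?_ (Nat.find_spec h)
    rw [← Φ.bernoulli_cylinder]
    refine measure_mono ?_
    rintro η ⟨n, hn, he⟩ i hi
    exact he i (hi.trans_le (Nat.find_min' h hn))
  · have : {η | Φ.Agree θ ω η} = ∅ := Set.eq_empty_of_forall_notMem fun η hη => h ⟨_, hη.choose_spec.1⟩
    simp [this]

theorem le_bernoulli_agree {c θ : ENNReal} (hc : ∀ a, c ≤ ENNReal.ofReal (Φ.weight a))
    (hθ : θ ≤ 1) (ω : ℕ → Fin N) (h : ∃ n, Φ.prefixWeight ω n ≤ θ) :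
    c * θ ≤ Φ.bernoulli {η | Φ.Agree θ ω η} := by
  classical
  have h1 : c * θ ≤ Φ.prefixWeight ω (Nat.find h) := by
    rcases hm : Nat.find h with _ | m
    · simpa [prefixWeight] using mul_le_mul' ((hc 0).trans (Φ.ofReal_weight_le_one 0)) hθ
    · have := Nat.find_min h (m := m) (by omega)
      rw [prefixWeight, Finset.prod_range_succ, mul_comm]
      exact mul_le_mul' (not_le.1 this).le (hc _)
  rw [← Φ.bernoulli_cylinder] at h1
  refine h1.trans (measure_mono fun η hη => ?_)
  exact ⟨_, Nat.find_spec h, hη⟩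

/-- The sequences `T^a ω` and `T^b ω`, `a < b`, agree on a prefix of weight at most `θ` with
probability at most `θ`, even if they overlap and `θ` depends on the first `b` letters of `ω`:
given these letters, the agreement says that `T^b ω` starts like the periodic sequence
`(ω_a … ω_{b-1})^∞`. -/
theorem lintegral_agree_shift_le {a b : ℕ} (hab : a < b) {f θ : (ℕ → Fin N) → ENNReal}
    (hf : Measurable f) (hθ : Measurable θ)
    (hfb : ∀ ω η, f (splice b ω η) = f ω) (hθb : ∀ ω η, θ (splice b ω η) = θ ω) :
    ∫⁻ ω, {ω | Φ.Agree (θ ω) (shift a ω) (shift b ω)}.indicator f ω ∂Φ.bernoulli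
      ≤ ∫⁻ ω, f ω * θ ω ∂Φ.bernoulli := by
  have hm := Φ.measurableSet_agree hθ (measurable_shift a) (measurable_shift b)
  rw [← Φ.lintegral_splice b (hf.indicator hm)]
  refine lintegral_mono fun ω => ?_
  let per : ℕ → Fin N := fun k => ω (a + k % (b - a))
  have key : ∀ η, Φ.Agree (θ ω) (shift a (splice b ω η)) η → Φ.Agree (θ ω) per η := by
    rintro η ⟨n, hn, he⟩
    have h : ∀ i < n, per i = η i := by
      intro i
      induction i using Nat.strong_induction_on with
      | _ i ih =>
        intro hi
        rw [← he i hi]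
        rcases lt_or_ge i (b - a) with h | h
        · have h1 : a + i < b := by omega
          simp [per, shift, splice_of_lt h1, Nat.mod_eq_of_lt h]
        · have h1 : shift a (splice b ω η) i = η (i - (b - a)) := by
            rw [← splice_add b (i - (b - a)) ω η, shift]
            congr 1
            omega
          rw [h1, ← ih (i - (b - a)) (by omega) (by omega)]
          simp only [per]
          rw [Nat.mod_eq_sub_mod h]
    refine ⟨n, ?_, h⟩
    rwa [Φ.prefixWeight_congr h, ← Φ.prefixWeight_congr he]
  have hmη : MeasurableSet {η | Φ.Agree (θ ω) per η} :=
    Φ.measurableSet_agree measurable_const measurable_const measurable_id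
  calc ∫⁻ η, {ω | Φ.Agree (θ ω) (shift a ω) (shift b ω)}.indicator f (splice b ω η) ∂Φ.bernoulli
      ≤ ∫⁻ η, {η | Φ.Agree (θ ω) per η}.indicator (fun _ => f ω) η ∂Φ.bernoulli := by
        refine lintegral_mono fun η => ?_
        by_cases h : Φ.Agree (θ ω) (shift a (splice b ω η)) η
        · rw [Set.indicator_of_mem (s := {η | Φ.Agree (θ ω) per η}) (key η h)]
          exact (Set.indicator_le_self _ _ _).trans (hfb ω η).le
        · rw [Set.indicator_of_notMem]
          · exact zero_le
          · simpa [hθb, shift_splice] using h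
    _ = f ω * Φ.bernoulli {η | Φ.Agree (θ ω) per η} := lintegral_indicator_const hmη _
    _ ≤ f ω * θ ω := by gcongr; exact Φ.bernoulli_agree_le _ _

/-! ### Second moment of the number of repetitions -/

theorem bernoulli_eqOn_agree_le (α β : ℕ → Fin N) {m j : ℕ} (hmj : m ≤ j) (ψ : ENNReal) :
    Φ.bernoulli {η | (∀ i < m, α i = η i) ∧ Φ.Agree ψ β (shift j η)}
      ≤ Φ.prefixWeight α m * ψ := by
  have hA := measurableSet_eqOn α m
  have hB : MeasurableSet {η | Φ.Agree ψ β (shift j η)} :=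
    Φ.measurableSet_agree measurable_const measurable_const (measurable_shift j)
  have h := Φ.bernoulli_inter j hA hB
    (fun ω η h => forall₂_congr fun i hi => by rw [h i (hi.trans_le hmj)])
    (fun ω η h => by
      have : shift j ω = shift j η := funext fun k => h _ (Nat.le_add_right j k)
      simp [this])
  rw [Set.ofPred_and, h, bernoulli_cylinder]
  gcongr
  have h2 := Φ.measure_shift j (A := {η | Φ.Agree ψ β η})
    (Φ.measurableSet_agree measurable_const measurable_const measurable_id)
  exact (le_of_eq h2).trans (Φ.bernoulli_agree_le ψ β)

/-- A random sequence `η` resembles `α`, and `T^j η` resembles `β`, with probability `ψ ^ 2` up to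
the correction that comes from overlaps; an overlap forces `T^j α` to resemble `β`. -/
theorem bernoulli_agree_agree_le (α β : ℕ → Fin N) (j : ℕ) (ψ : ENNReal) {ε : ENNReal}
    (hε : Φ.Agree (ψ / Φ.prefixWeight α j) (shift j α) β → Φ.prefixWeight α j ≤ ε) :
    Φ.bernoulli {η | Φ.Agree ψ α η ∧ Φ.Agree ψ β (shift j η)} ≤ ψ ^ 2 + ψ * ε := by
  classical
  by_cases h : ∃ n, Φ.prefixWeight α n ≤ ψ
  swap
  · have : {η | Φ.Agree ψ α η ∧ Φ.Agree ψ β (shift j η)} = ∅ :=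
      Set.eq_empty_of_forall_notMem fun η hη => h ⟨_, hη.1.choose_spec.1⟩
    simp [this]
  obtain ⟨m, hm, hmin⟩ : ∃ m, Φ.prefixWeight α m ≤ ψ ∧
      ∀ η, Φ.Agree ψ α η → ∀ i < m, α i = η i :=
    ⟨Nat.find h, Nat.find_spec h, fun η ⟨n, hn, he⟩ i hi =>
      he i (hi.trans_le (Nat.find_min' h hn))⟩
  rcases le_or_gt m j with hmj | hmj
  · refine le_trans ?_ le_self_add
    rw [sq]
    refine le_trans (measure_mono ?_) ((Φ.bernoulli_eqOn_agree_le α β hmj ψ).trans (by gcongr))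
    exact fun η hη => ⟨hmin η hη.1, hη.2⟩
  refine le_trans ?_ le_add_self
  by_cases hag : Φ.Agree (ψ / Φ.prefixWeight α j) (shift j α) β
  · rw [mul_comm]
    refine le_trans (measure_mono ?_)
      ((Φ.bernoulli_eqOn_agree_le α β le_rfl ψ).trans (mul_le_mul_left (hε hag) ψ))
    exact fun η hη => ⟨fun i hi => hmin η hη.1 i (hi.trans hmj), hη.2⟩
  · have : {η | Φ.Agree ψ α η ∧ Φ.Agree ψ β (shift j η)} = ∅ := by
      refine Set.eq_empty_of_forall_notMem fun η hη => hag ?_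
      have h1 := hmin η hη.1
      obtain ⟨n, hn, he⟩ := hη.2
      rcases le_total (m - j) n with hle | hle
      · refine ⟨m - j, ?_, fun i hi => ?_⟩
        · rw [ENNReal.le_div_iff_mul_le (Or.inl (Φ.prefixWeight_ne_zero _ _))
            (Or.inl (Φ.prefixWeight_ne_top _ _)), mul_comm, ← prefixWeight_add]
          rwa [Nat.add_sub_cancel' hmj.le]
        · rw [he i (hi.trans_le hle)]
          exact h1 _ (by omega)
      · have h2 : ∀ i < n, shift j α i = β i := fun i hi => by
          rw [he i hi]
          exact h1 _ (by omega)
        refine ⟨n, ?_, h2⟩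
        rw [Φ.prefixWeight_congr h2]
        refine hn.trans ?_
        rw [ENNReal.le_div_iff_mul_le (Or.inl (Φ.prefixWeight_ne_zero _ _))
            (Or.inl (Φ.prefixWeight_ne_top _ _))]
        exact mul_le_of_le_one_right' (Φ.prefixWeight_le_one _ _)
    simp [this]

end Words

section Repetitions

variable {d N : ℕ} [NeZero N] (Φ : RationalIFS d N)

theorem lintegral_agree_agree_le_of_ne {l l' j : ℕ} (h : l + j ≠ l') (ψ : ENNReal) :
    ∫⁻ ω, Φ.bernoulli {η | Φ.Agree ψ (shift l ω) η ∧ Φ.Agree ψ (shift l' ω) (shift j η)}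
      ∂Φ.bernoulli ≤ 2 * ψ ^ 2 := by
  let f : (ℕ → Fin N) → ENNReal := fun ω => Φ.prefixWeight (shift l ω) j
  have hf : Measurable f := (Φ.measurable_prefixWeight j).comp (measurable_shift l)
  have hfb : ∀ b, l + j ≤ b → ∀ ω η, f (splice b ω η) = f ω := fun b hb ω η =>
    Φ.prefixWeight_congr fun i hi => splice_of_lt (by omega) ω η
  have hmul : ∀ ω, f ω * (ψ / f ω) = ψ := fun ω =>
    ENNReal.mul_div_cancel (Φ.prefixWeight_ne_zero _ _) (Φ.prefixWeight_ne_top _ _)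
  let S : Set (ℕ → Fin N) := {ω | Φ.Agree (ψ / f ω) (shift (l + j) ω) (shift l' ω)}
  have hS : MeasurableSet S := Φ.measurableSet_agree (measurable_const.div hf)
    (measurable_shift _) (measurable_shift _)
  have key : ∫⁻ ω, S.indicator f ω ∂Φ.bernoulli ≤ ψ := by
    have e : ∫⁻ ω, f ω * (ψ / f ω) ∂Φ.bernoulli = ψ := by simp [hmul]
    rcases lt_or_gt_of_ne h with h | h
    · exact (Φ.lintegral_agree_shift_le h hf (measurable_const.div hf) (hfb _ h.le)
        fun ω η => by simp only [Pi.div_apply, hfb _ h.le]).trans e.le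
    · have : S = {ω | Φ.Agree (ψ / f ω) (shift l' ω) (shift (l + j) ω)} :=
        Set.ext fun ω => ⟨Agree.symm Φ, Agree.symm Φ⟩
      rw [this]
      exact (Φ.lintegral_agree_shift_le h hf (measurable_const.div hf) (hfb _ le_rfl)
        fun ω η => by simp only [Pi.div_apply, hfb _ le_rfl]).trans e.le
  calc _ ≤ ∫⁻ ω, ψ ^ 2 + ψ * S.indicator f ω ∂Φ.bernoulli := by
        refine lintegral_mono fun ω => Φ.bernoulli_agree_agree_le _ _ j ψ fun hag => ?_
        have hω : ω ∈ S := by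
          rw [shift_shift] at hag
          exact hag
        exact (Set.indicator_of_mem hω f).ge
    _ = ψ ^ 2 + ψ * ∫⁻ ω, S.indicator f ω ∂Φ.bernoulli := by
        rw [lintegral_add_left measurable_const, lintegral_const_mul _ (hf.indicator hS)]
        simp
    _ ≤ ψ ^ 2 + ψ * ψ := by gcongr
    _ = _ := by ring

theorem lintegral_agree_agree_le {ρ : ENNReal} (hρ : ∀ a, ENNReal.ofReal (Φ.weight a) ≤ ρ)
    (l l' j : ℕ) (ψ : ENNReal) :
    ∫⁻ ω, Φ.bernoulli {η | Φ.Agree ψ (shift l ω) η ∧ Φ.Agree ψ (shift l' ω) (shift j η)}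
      ∂Φ.bernoulli ≤ 2 * ψ ^ 2 + if l + j = l' then ψ * ρ ^ j else 0 := by
  split_ifs with h
  · refine (lintegral_mono (g := fun _ => ψ ^ 2 + ψ * ρ ^ j) fun ω =>
      Φ.bernoulli_agree_agree_le _ _ j ψ fun _ => Φ.prefixWeight_le_pow hρ _ _).trans ?_
    rw [lintegral_const, measure_univ, mul_one, two_mul]
    gcongr
    exact le_self_add
  · simpa using Φ.lintegral_agree_agree_le_of_ne h ψ

/-- The pairs `(ω, η)` for which `T^l ω` and `T^n η` agree on a prefix of weight at most `ψ`;
here `(l, n) = p`. -/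
def repetition (ψ : ENNReal) (p : ℕ × ℕ) : Set ((ℕ → Fin N) × (ℕ → Fin N)) :=
  {x | Φ.Agree ψ (shift p.1 x.1) (shift p.2 x.2)}

theorem measurableSet_repetition (ψ : ENNReal) (p : ℕ × ℕ) :
    MeasurableSet (Φ.repetition ψ p) :=
  Φ.measurableSet_agree measurable_const ((measurable_shift _).comp measurable_fst)
    ((measurable_shift _).comp measurable_snd)

theorem le_prod_repetition {c ψ : ENNReal} (hc : ∀ a, c ≤ ENNReal.ofReal (Φ.weight a))
    (hψ : ψ ≤ 1) {k : ℕ} (hk : ∀ ω, Φ.prefixWeight ω k ≤ ψ) (p : ℕ × ℕ) :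
    c * ψ ≤ (Φ.bernoulli.prod Φ.bernoulli) (Φ.repetition ψ p) := by
  rw [Measure.prod_apply (Φ.measurableSet_repetition ψ p)]
  calc c * ψ = ∫⁻ _, c * ψ ∂Φ.bernoulli := by simp
    _ ≤ _ := lintegral_mono fun ω => ?_
  have h := Φ.measure_shift p.2 (A := {η | Φ.Agree ψ (shift p.1 ω) η})
    (Φ.measurableSet_agree measurable_const measurable_const measurable_id)
  exact (Φ.le_bernoulli_agree hc hψ _ ⟨k, hk _⟩).trans h.ge

theorem prod_repetition_inter_le {ρ : ENNReal} (hρ : ∀ a, ENNReal.ofReal (Φ.weight a) ≤ ρ)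
    (ψ : ENNReal) (p q : ℕ × ℕ) :
    (Φ.bernoulli.prod Φ.bernoulli) (Φ.repetition ψ p ∩ Φ.repetition ψ q)
      ≤ 2 * ψ ^ 2 + if p.1 + q.2 = q.1 + p.2 then ψ * ρ ^ (Nat.dist p.2 q.2) else 0 := by
  wlog h : p.2 ≤ q.2 generalizing p q
  · have := this q p (le_of_not_ge h)
    rw [Set.inter_comm, Nat.dist_comm]
    simpa only [eq_comm] using this
  rw [Measure.prod_apply ((Φ.measurableSet_repetition ψ p).inter (Φ.measurableSet_repetition ψ q)),
    Nat.dist_eq_sub_of_le h]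
  have h1 := Φ.lintegral_agree_agree_le hρ p.1 q.1 (q.2 - p.2) ψ
  have h2 : (p.1 + (q.2 - p.2) = q.1) = (p.1 + q.2 = q.1 + p.2) := by
    apply propext; omega
  simp only [h2] at h1
  refine (lintegral_mono fun ω => le_of_eq ?_).trans h1
  rw [← Φ.measure_shift p.2 (A := {η | Φ.Agree ψ (shift p.1 ω) η ∧
    Φ.Agree ψ (shift q.1 ω) (shift (q.2 - p.2) η)})
    ((Φ.measurableSet_agree measurable_const measurable_const measurable_id).inter
      (Φ.measurableSet_agree measurable_const measurable_const (measurable_shift _)))]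
  congr 1
  ext η
  simp [repetition, shift_shift, Nat.add_sub_cancel' h]

omit [NeZero N] in
theorem sum_pow_dist_le (ρ : ENNReal) {M n : ℕ} (hn : n < M) :
    ∑ m ∈ Finset.range M, ρ ^ Nat.dist n m ≤ 2 * (1 - ρ)⁻¹ := by
  calc ∑ m ∈ Finset.range M, ρ ^ Nat.dist n m
      ≤ ∑ m ∈ Finset.range M, ∑ i ∈ Finset.range M,
          ((if m = n + i then ρ ^ i else 0) + if m = n - i then ρ ^ i else 0) := by
        refine Finset.sum_le_sum fun m hm => ?_
        have hm := Finset.mem_range.1 hm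
        refine le_trans ?_ (Finset.single_le_sum (a := Nat.dist n m) (fun _ _ => zero_le) ?_)
        · rcases le_total n m with h | h
          · rw [Nat.dist_eq_sub_of_le h, if_pos (by omega)]
            exact le_self_add
          · rw [Nat.dist_eq_sub_of_le_right h, if_pos (c := m = n - (n - m)) (by omega)]
            exact le_add_self
        · rw [Finset.mem_range, Nat.dist]
          omega
    _ ≤ ∑ i ∈ Finset.range M, 2 * ρ ^ i := by
        rw [Finset.sum_comm]
        refine Finset.sum_le_sum fun i _ => ?_
        rw [Finset.sum_add_distrib, Finset.sum_ite_eq', Finset.sum_ite_eq', two_mul]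
        gcongr <;> split_ifs <;> simp
    _ ≤ _ := by
        rw [← Finset.mul_sum, ← ENNReal.tsum_geometric]
        gcongr
        exact ENNReal.sum_le_tsum _

theorem sum_prod_repetition_inter_le {ρ : ENNReal} (hρ : ∀ a, ENNReal.ofReal (Φ.weight a) ≤ ρ)
    {ψ : ENNReal} {M : ℕ} (hM : (M : ENNReal) ^ 2 * ψ ≤ 1) :
    ∑ p ∈ Finset.range M ×ˢ Finset.range M, ∑ q ∈ Finset.range M ×ˢ Finset.range M,
      (Φ.bernoulli.prod Φ.bernoulli) (Φ.repetition ψ p ∩ Φ.repetition ψ q)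
      ≤ (2 + 2 * (1 - ρ)⁻¹) * ((M : ENNReal) ^ 2 * ψ) := by
  have h1 : ∀ p ∈ Finset.range M ×ˢ Finset.range M, ∑ q ∈ Finset.range M ×ˢ Finset.range M,
      (Φ.bernoulli.prod Φ.bernoulli) (Φ.repetition ψ p ∩ Φ.repetition ψ q)
      ≤ (M : ENNReal) ^ 2 * (2 * ψ ^ 2) + ψ * (2 * (1 - ρ)⁻¹) := by
    intro p hp
    have hp2 := Finset.mem_range.1 (Finset.mem_product.1 hp).2
    refine (Finset.sum_le_sum fun q _ => Φ.prod_repetition_inter_le hρ ψ p q).trans ?_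
    rw [Finset.sum_add_distrib]
    refine add_le_add (by simp [sq]) ?_
    refine le_trans ?_ (mul_le_mul_right (sum_pow_dist_le ρ hp2) ψ)
    rw [Finset.sum_product_right, Finset.mul_sum]
    refine Finset.sum_le_sum fun m _ => ?_
    calc _ ≤ ∑ x ∈ Finset.range M, if x = p.1 + m - p.2 then ψ * ρ ^ Nat.dist p.2 m else 0 := by
          refine Finset.sum_le_sum fun x _ => ?_
          by_cases h : p.1 + m = x + p.2
          · rw [if_pos h, if_pos (by omega)]
          · rw [if_neg h]
            exact zero_le
      _ ≤ _ := by
          rw [Finset.sum_ite_eq']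
          split_ifs <;> simp
  refine (Finset.sum_le_sum h1).trans ?_
  rw [Finset.sum_const, Finset.card_product, Finset.card_range, nsmul_eq_mul]
  push_cast
  calc (M : ENNReal) * M * (M ^ 2 * (2 * ψ ^ 2) + ψ * (2 * (1 - ρ)⁻¹))
      = (2 * (M ^ 2 * ψ) + 2 * (1 - ρ)⁻¹) * (M ^ 2 * ψ) := by ring
    _ ≤ _ := by
      gcongr
      exact mul_le_of_le_one_right' hM

/-- A second moment bound for the probability that at least one of finitely many events occurs:
integrate `2 t Z ≤ 1_{Z ≠ 0} + t ^ 2 Z ^ 2`, where `Z` counts these events. -/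
theorem two_mul_sum_measure_le {Ω ι : Type*} [MeasurableSpace Ω] (P : Measure Ω) (s : Finset ι)
    {A : ι → Set Ω} (hA : ∀ i, MeasurableSet (A i)) (t : NNReal) :
    2 * (t * ∑ i ∈ s, P (A i))
      ≤ P (⋃ i ∈ s, A i) + t ^ 2 * ∑ i ∈ s, ∑ j ∈ s, P (A i ∩ A j) := by
  let Z : Ω → NNReal := fun x => ∑ i ∈ s, (A i).indicator 1 x
  have hZ : ∀ x, ((Z x : NNReal) : ENNReal) = ∑ i ∈ s, (A i).indicator 1 x := by
    intro x
    simp only [Z]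
    push_cast
    refine Finset.sum_congr rfl fun i _ => ?_
    by_cases h : x ∈ A i <;> simp [h]
  have hZm : ∀ i, Measurable ((A i).indicator (1 : Ω → ENNReal)) := fun i =>
    measurable_one.indicator (hA i)
  have hsum : ∑ i ∈ s, P (A i) = ∫⁻ x, Z x ∂P := by
    simp only [hZ]
    rw [lintegral_finsetSum _ fun i _ => hZm i]
    exact Finset.sum_congr rfl fun i _ => (lintegral_indicator_one (hA i)).symm
  have hsq : ∑ i ∈ s, ∑ j ∈ s, P (A i ∩ A j) = ∫⁻ x, (Z x : ENNReal) ^ 2 ∂P := by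
    simp only [hZ, sq, Finset.sum_mul_sum]
    have hm : ∀ i j, Measurable fun x => (A i).indicator (1 : Ω → ENNReal) x *
        (A j).indicator (1 : Ω → ENNReal) x := fun i j => (hZm i).mul (hZm j)
    rw [lintegral_finsetSum _ fun i _ => Finset.measurable_fun_sum _ fun j _ => hm i j]
    refine Finset.sum_congr rfl fun i _ => ?_
    rw [lintegral_finsetSum _ fun j _ => hm i j]
    refine Finset.sum_congr rfl fun j _ => ?_
    rw [← lintegral_indicator_one ((hA i).inter (hA j))]
    refine lintegral_congr fun x => ?_
    rw [Set.inter_indicator_one, Pi.mul_apply]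
  have hZmeas : Measurable fun x => (Z x : ENNReal) := by
    simp only [hZ]
    exact Finset.measurable_fun_sum _ fun i _ => hZm i
  have hU : MeasurableSet (⋃ i ∈ s, A i) := s.measurableSet_biUnion fun i _ => hA i
  rw [hsum, hsq, ← lintegral_indicator_one hU, ← lintegral_const_mul _ hZmeas,
    ← lintegral_const_mul _ (hZmeas.const_mul _), ← lintegral_const_mul _ (hZmeas.pow_const 2),
    ← lintegral_add_left (measurable_one.indicator hU)]
  refine lintegral_mono fun x => ?_
  by_cases hx : x ∈ ⋃ i ∈ s, A i
  · simp only [Set.indicator_of_mem hx, Pi.one_apply]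
    norm_cast
    have := two_mul_le_add_sq (1 : NNReal) (t * Z x)
    calc 2 * (t * Z x) = 2 * 1 * (t * Z x) := by ring
      _ ≤ 1 ^ 2 + (t * Z x) ^ 2 := this
      _ = _ := by ring
  · have : (Z x : ENNReal) = 0 := by
      rw [hZ]
      refine Finset.sum_eq_zero fun i hi => Set.indicator_of_notMem (fun h => hx ?_) _
      exact Set.mem_biUnion hi h
    simp [this]

/-- If `M ^ 2 ψ ≤ 1`, then two independent sequences have a common word of weight about `ψ`
starting at one of the first `M` positions of each with probability at least a constant times
`M ^ 2 ψ`. -/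
theorem le_prod_iUnion_repetition {c ρ : NNReal}
    (hc : ∀ a, (c : ENNReal) ≤ ENNReal.ofReal (Φ.weight a)) (hρ1 : ρ < 1)
    (hρ : ∀ a, ENNReal.ofReal (Φ.weight a) ≤ ρ) {ψ : ENNReal} {M k : ℕ}
    (hψ : ψ ≤ 1) (hM : (M : ENNReal) ^ 2 * ψ ≤ 1) (hk : ∀ ω, Φ.prefixWeight ω k ≤ ψ) :
    ((c ^ 2 * (2 + 2 * (1 - ρ)⁻¹)⁻¹ : NNReal) : ENNReal) * ((M : ENNReal) ^ 2 * ψ)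
      ≤ (Φ.bernoulli.prod Φ.bernoulli)
        (⋃ p ∈ Finset.range M ×ˢ Finset.range M, Φ.repetition ψ p) := by
  set C : NNReal := 2 + 2 * (1 - ρ)⁻¹ with hC
  have hC0 : C ≠ 0 := by positivity
  set x : ENNReal := (M : ENNReal) ^ 2 * ψ with hx
  have hxt : x ≠ ⊤ := (hM.trans_lt ENNReal.one_lt_top).ne
  have h1 : (c : ENNReal) * x
      ≤ ∑ p ∈ Finset.range M ×ˢ Finset.range M,
        (Φ.bernoulli.prod Φ.bernoulli) (Φ.repetition ψ p) := by
    refine le_trans ?_ (Finset.sum_le_sum fun p _ => Φ.le_prod_repetition hc hψ hk p)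
    rw [Finset.sum_const, Finset.card_product, Finset.card_range, nsmul_eq_mul, hx]
    push_cast
    exact le_of_eq (by ring)
  have h2 : ∑ p ∈ Finset.range M ×ˢ Finset.range M, ∑ q ∈ Finset.range M ×ˢ Finset.range M,
      (Φ.bernoulli.prod Φ.bernoulli) (Φ.repetition ψ p ∩ Φ.repetition ψ q) ≤ C * x := by
    refine (Φ.sum_prod_repetition_inter_le hρ hM).trans (le_of_eq ?_)
    have : (1 : NNReal) - ρ ≠ 0 := (tsub_pos_of_lt hρ1).ne'
    rw [hC]
    push_cast [ENNReal.coe_inv this]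
    rfl
  have h3 := two_mul_sum_measure_le (Φ.bernoulli.prod Φ.bernoulli)
    (Finset.range M ×ˢ Finset.range M) (Φ.measurableSet_repetition ψ) (c * C⁻¹)
  -- The choice `t = c / C` optimises `2 t (c x) - t ^ 2 (C x)`.
  have h4 : (2 : ENNReal) * ((c * C⁻¹ : NNReal) * (c * x))
      ≤ (Φ.bernoulli.prod Φ.bernoulli)
          (⋃ p ∈ Finset.range M ×ˢ Finset.range M, Φ.repetition ψ p)
        + ((c * C⁻¹ : NNReal) : ENNReal) ^ 2 * (C * x) :=
    le_trans (by gcongr) (h3.trans (by gcongr))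
  have e1 : ((c * C⁻¹ : NNReal) : ENNReal) * (c * x) = (c ^ 2 * C⁻¹ : NNReal) * x := by
    push_cast; ring
  have e2 : ((c * C⁻¹ : NNReal) : ENNReal) ^ 2 * (C * x) = (c ^ 2 * C⁻¹ : NNReal) * x := by
    rw [← mul_assoc]
    congr 1
    norm_cast
    field_simp
  rw [e1, e2, two_mul] at h4
  exact ENNReal.le_of_add_le_add_right (ENNReal.mul_ne_top ENNReal.coe_ne_top hxt) h4

/-! ### Independent blocks -/

/-- Some word of weight at most `ψ` and length at most `M` occurs in `ω` at a position in
`[M, 2M)` and at a position in `[3M, 4M)`. -/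
def blockEvent (M : ℕ) (ψ : ENNReal) : Set (ℕ → Fin N) :=
  {ω | ∃ l < M, ∃ n < M, ∃ m ≤ M, Φ.prefixWeight (shift (M + l) ω) m ≤ ψ ∧
    ∀ i < m, ω (M + l + i) = ω (3 * M + n + i)}

theorem mem_blockEvent_congr {M : ℕ} {ψ : ENNReal} {ω η : ℕ → Fin N}
    (h : ∀ k, M ≤ k → k < 5 * M → ω k = η k) :
    ω ∈ Φ.blockEvent M ψ ↔ η ∈ Φ.blockEvent M ψ := by
  suffices H : ∀ ω η : ℕ → Fin N, (∀ k, M ≤ k → k < 5 * M → ω k = η k) →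
      ω ∈ Φ.blockEvent M ψ → η ∈ Φ.blockEvent M ψ from
    ⟨H ω η h, H η ω fun k h1 h2 => (h k h1 h2).symm⟩
  rintro ω η h ⟨l, hl, n, hn, m, hm, hw, he⟩
  refine ⟨l, hl, n, hn, m, hm, ?_, fun i hi => ?_⟩
  · have e : ∀ i < m, shift (M + l) ω i = shift (M + l) η i := fun i hi =>
      h _ (by omega) (by omega)
    rwa [← Φ.prefixWeight_congr e]
  · rw [← h _ (by omega) (by omega), ← h _ (by omega) (by omega)]
    exact he i hi

theorem measurableSet_blockEvent (M : ℕ) (ψ : ENNReal) : MeasurableSet (Φ.blockEvent M ψ) := by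
  simp only [blockEvent, Set.ofPred_exists, Set.ofPred_and, Set.ofPred_forall]
  refine MeasurableSet.iUnion fun l => (MeasurableSet.const _).inter <|
    MeasurableSet.iUnion fun n => (MeasurableSet.const _).inter <|
    MeasurableSet.iUnion fun m => (MeasurableSet.const _).inter <|
    (measurableSet_le ((Φ.measurable_prefixWeight m).comp (measurable_shift _))
      measurable_const).inter <| MeasurableSet.iInter fun i => MeasurableSet.iInter fun _ =>
    measurableSet_eq_fun (measurable_pi_apply _) (measurable_pi_apply _)

theorem le_bernoulli_blockEvent {c ρ : NNReal}
    (hc : ∀ a, (c : ENNReal) ≤ ENNReal.ofReal (Φ.weight a)) (hρ1 : ρ < 1)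
    (hρ : ∀ a, ENNReal.ofReal (Φ.weight a) ≤ ρ) {ψ : ENNReal} {M : ℕ}
    (hM0 : 0 < M) (hM : (M : ENNReal) ^ 2 * ψ ≤ 1) (hk : (ρ : ENNReal) ^ M ≤ ψ) :
    ((c ^ 2 * (2 + 2 * (1 - ρ)⁻¹)⁻¹ : NNReal) : ENNReal) * ((M : ENNReal) ^ 2 * ψ)
      ≤ Φ.bernoulli (Φ.blockEvent M ψ) := by
  have hψ : ψ ≤ 1 := by
    refine le_trans ?_ hM
    exact le_mul_of_one_le_left' (one_le_pow₀ (by exact_mod_cast hM0))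
  have hk' : ∀ ω, Φ.prefixWeight ω M ≤ ψ := fun ω => (Φ.prefixWeight_le_pow hρ ω M).trans hk
  refine (Φ.le_prod_iUnion_repetition hc hρ1 hρ hψ hM hk').trans ?_
  have hR : MeasurableSet (⋃ p ∈ Finset.range M ×ˢ Finset.range M, Φ.repetition ψ p) :=
    Finset.measurableSet_biUnion _ fun p _ => Φ.measurableSet_repetition ψ p
  rw [Measure.prod_apply hR, ← Φ.measure_splice (3 * M) (Φ.measurableSet_blockEvent M ψ),
    ← Φ.lintegral_shift M (measurable_measure_prodMk_left hR)]
  refine lintegral_mono fun ω => measure_mono fun η hη => ?_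
  simp only [Set.mem_preimage, Set.mem_iUnion, Finset.mem_product, Finset.mem_range] at hη
  obtain ⟨p, ⟨hp1, hp2⟩, m, hm, he⟩ := hη
  -- Prefixes of length `M` already have weight at most `ψ`, so `m` may be cut down to `M`.
  have hm' : Φ.prefixWeight (shift p.1 (shift M ω)) (min m M) ≤ ψ := by
    rcases min_choice m M with h | h <;> rw [h]
    exacts [hm, hk' _]
  have hl : ∀ i < min m M, shift (M + p.1) (splice (3 * M) ω η) i = shift p.1 (shift M ω) i := by
    intro i hi
    rw [shift_shift]
    exact splice_of_lt (by omega) ω η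
  refine ⟨p.1, hp1, p.2, hp2, min m M, min_le_right _ _, ?_, fun i hi => ?_⟩
  · rwa [Φ.prefixWeight_congr hl]
  · refine (hl i hi).trans ((he i (hi.trans_le (min_le_left _ _))).trans ?_)
    rw [add_assoc, splice_add]
    rfl

/-- Events that depend on disjoint consecutive blocks of letters occur infinitely often almost
surely if their probabilities have a divergent sum. -/
theorem ae_frequently_of_blocks {B : ℕ → Set (ℕ → Fin N)} (hB : ∀ j, MeasurableSet (B j))
    {b : ℕ → ℕ} (hb : Monotone b)
    (hdep : ∀ j ω η, (∀ k, b j ≤ k → k < b (j + 1) → ω k = η k) → (ω ∈ B j ↔ η ∈ B j))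
    (hsum : ∑' j, Φ.bernoulli (B j) = ⊤) :
    ∀ᵐ ω ∂Φ.bernoulli, ∃ᶠ j in atTop, ω ∈ B j := by
  have hind : ProbabilityTheory.iIndepSet B Φ.bernoulli := by
    rw [ProbabilityTheory.iIndepSet_iff_meas_biInter hB]
    intro s
    induction s using Finset.induction_on_max with
    | empty => simp
    | insert a s ha ih =>
      have hns : a ∉ s := fun h => (ha a h).false
      rw [Finset.set_biInter_insert, Finset.prod_insert hns, ← ih, Set.inter_comm, mul_comm]
      refine Φ.bernoulli_inter (b a) (s.measurableSet_biInter fun i _ => hB i) (hB a)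
        (fun ω η h => ?_) fun ω η h => hdep a ω η fun k hk _ => h k hk
      simp only [Set.mem_iInter]
      exact forall₂_congr fun i hi => hdep i ω η fun k _ hk => h k (hk.trans_le (hb (ha i hi)))
  have h := ProbabilityTheory.measure_limsup_eq_one hB hind hsum
  have h2 : ∀ᵐ ω ∂Φ.bernoulli, ω ∈ limsup B atTop :=
    (prob_compl_eq_zero_iff (MeasurableSet.measurableSet_limsup hB)).2 h
  filter_upwards [h2] with ω hω
  exact mem_limsup_iff_frequently_mem.1 hω

end Repetitions

section Codings

/-! ### Codings and eventually periodic sequences -/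

variable {d N : ℕ} (Φ : RationalIFS d N)

theorem coding_eq_wordMap (ω : ℕ → Fin N) (n : ℕ) :
    Φ.coding ω = Φ.wordMap (fun i : Fin n => ω i) (Φ.coding (shift n ω)) := by
  induction n with
  | zero => simp [wordMap_zero, shift_zero]
  | succ n ih =>
    rw [wordMap_succ_last, ih, coding_eq]
    congr 3
    funext k
    simp only [shift]
    congr 1
    ring

theorem dist_wordMap (ω : ℕ → Fin N) (n : ℕ) (x y : EuclideanSpace ℝ (Fin d)) :
    dist (Φ.wordMap (fun i : Fin n => ω i) x) (Φ.wordMap (fun i : Fin n => ω i) y)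
      = (∏ i ∈ Finset.range n, Φ.ratio (ω i)) * dist x y := by
  induction n generalizing x y with
  | zero => simp [wordMap_zero]
  | succ n ih =>
    rw [wordMap_succ_last, wordMap_succ_last, ih, dist_map, Finset.prod_range_succ, mul_assoc]

theorem exists_wordMap_eq (ω : ℕ → Fin N) (n : ℕ) : ∃ P : Fin d → ℤ, ∀ x,
    ((∏ i ∈ Finset.range n, Φ.q (ω i) : ℤ) : ℝ) • Φ.wordMap (fun i : Fin n => ω i) x
      = x + WithLp.toLp 2 fun i => (P i : ℝ) := by
  induction n with
  | zero => exact ⟨0, fun x => by ext; simp [wordMap_zero]⟩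
  | succ n ih =>
    obtain ⟨P, hP⟩ := ih
    refine ⟨fun i => Φ.p (ω n) i + Φ.q (ω n) * P i, fun x => ?_⟩
    have hq : (Φ.q (ω n) : ℝ) ≠ 0 := by
      have := Φ.two_le_q (ω n)
      intro h
      rw [h] at this
      norm_num at this
    rw [wordMap_succ_last, Finset.prod_range_succ, mul_comm, Int.cast_mul, mul_smul, hP, map,
      smul_add, smul_inv_smul₀ hq, add_assoc]
    congr 1
    ext i
    simp

theorem prod_ratio (ω : ℕ → Fin N) (n : ℕ) : ∏ i ∈ Finset.range n, Φ.ratio (ω i)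
    = |((∏ i ∈ Finset.range n, Φ.q (ω i) : ℤ) : ℝ)|⁻¹ := by
  simp [ratio, Finset.abs_prod, Finset.prod_inv_distrib]

theorem prod_ratio_pos (ω : ℕ → Fin N) (n : ℕ) : 0 < ∏ i ∈ Finset.range n, Φ.ratio (ω i) :=
  Finset.prod_pos fun _ _ => Φ.ratio_pos _

theorem prod_ratio_le (ω : ℕ → Fin N) (n : ℕ) :
    ∏ i ∈ Finset.range n, Φ.ratio (ω i) ≤ (1 / 2) ^ n := by
  simpa using Finset.prod_le_prod (s := Finset.range n) (fun i _ => (Φ.ratio_pos (ω i)).le)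
    fun _ _ => Φ.ratio_le _

theorem eventuallyPeriodic_of_lt (ω : ℕ → Fin N) {n : ℕ} (l : Fin n) {k : ℕ} (hk : k < n) :
    eventuallyPeriodic (fun i : Fin n => ω i) l k = ω k := by
  unfold eventuallyPeriodic
  split_ifs with h
  · rfl
  · simp only
    rw [Nat.mod_eq_of_lt (by omega), Nat.add_sub_cancel' (by omega)]

theorem shift_eventuallyPeriodic {n : ℕ} (a : Fin n → Fin N) (l : Fin n) :
    shift n (eventuallyPeriodic a l) = shift l (eventuallyPeriodic a l) := by
  funext k
  have hl := l.2
  simp only [shift, eventuallyPeriodic]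
  rw [dif_neg (by omega), dif_neg (by omega)]
  congr 2
  rw [show n + k - (l : ℕ) = (l + k - l) + (n - l) by omega, Nat.add_mod_right]

/-- If the letters of `ω` after the `n`-th repeat those after the `l`-th for `m` steps, then `ω`
agrees for `n + m` letters with its eventually periodic continuation. -/
theorem eventuallyPeriodic_eq (ω : ℕ → Fin N) {n m : ℕ} (l : Fin n)
    (h : ∀ i < m, ω (l + i) = ω (n + i)) {k : ℕ} (hk : k < n + m) :
    eventuallyPeriodic (fun i : Fin n => ω i) l k = ω k := by
  induction k using Nat.strong_induction_on with
  | _ k ih =>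
    rcases lt_or_ge k n with hkn | hkn
    · exact eventuallyPeriodic_of_lt ω l hkn
    · obtain ⟨i, rfl⟩ := Nat.exists_eq_add_of_le hkn
      have hl := l.2
      have h1 := congrFun (shift_eventuallyPeriodic (fun i : Fin n => ω i) l) i
      simp only [shift] at h1
      rw [h1, ih (l + i) (by omega) (by omega), h i (by omega)]

theorem exists_isReducedForm {y : EuclideanSpace ℝ (Fin d)} {K : ℤ} (hK : K ≠ 0)
    {P : Fin d → ℤ} (h : (K : ℝ) • y = WithLp.toLp 2 fun i => (P i : ℝ)) :
    ∃ (p : Fin d → ℤ) (q : ℕ), IsReducedForm p q ∧ ratPoint p q = y ∧ (q : ℝ) ≤ |(K : ℝ)| := by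
  classical
  have hKabs : 0 < K.natAbs ∧ ∃ p : Fin d → ℤ, ∀ i, (K.natAbs : ℝ) * y i = p i := by
    refine ⟨Int.natAbs_pos.2 hK, fun i => K.sign * P i, fun i => ?_⟩
    have h1 : (K : ℝ) * y i = P i := by
      have := congrArg (fun v : EuclideanSpace ℝ (Fin d) => v i) h
      simpa using this
    have h2 : ((K.natAbs : ℕ) : ℝ) = (K.sign : ℝ) * K := by
      have := Int.sign_mul_self_eq_natAbs K
      rw [Nat.cast_natAbs]
      exact_mod_cast this.symm
    rw [h2, mul_assoc, h1]
    push_cast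
    rfl
  have hex : ∃ q : ℕ, 0 < q ∧ ∃ p : Fin d → ℤ, ∀ i, (q : ℝ) * y i = p i := ⟨_, hKabs⟩
  obtain ⟨hq0, p, hp⟩ := Nat.find_spec hex
  set q := Nat.find hex with hq
  have hq0' : (q : ℝ) ≠ 0 := by exact_mod_cast hq0.ne'
  refine ⟨p, q, ⟨hq0, fun k hkq hkp => ?_⟩, ?_, ?_⟩
  · obtain ⟨r, hr⟩ := hkq
    have hk0 : k ≠ 0 := by rintro rfl; omega
    have hr0 : 0 < r := Nat.pos_of_ne_zero (by rintro rfl; omega)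
    have hqr : q ≤ r := by
      refine Nat.find_min' hex ⟨hr0, fun i => p i / k, fun i => ?_⟩
      obtain ⟨t, ht⟩ := hkp i
      have h1 := hp i
      rw [hr, ht] at h1
      have hk0' : (k : ℝ) ≠ 0 := by exact_mod_cast hk0
      simp only
      rw [ht, Int.mul_ediv_cancel_left _ (by exact_mod_cast hk0)]
      push_cast at h1
      rw [mul_assoc] at h1
      exact mul_left_cancel₀ hk0' h1
    have : k * r ≤ 1 * r := by omega
    have := Nat.le_of_mul_le_mul_right this hr0
    omega
  · ext i
    simp only [ratPoint]
    rw [← hp i]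
    field_simp
  · have : q ≤ K.natAbs := Nat.find_min' hex hKabs
    have h3 : (q : ℝ) ≤ (K.natAbs : ℝ) := by exact_mod_cast this
    rwa [Nat.cast_natAbs, Int.cast_abs] at h3

/-- With `z` the coding of the periodic tail, `φ_{a_1 … a_n}(z)` and `φ_{a_1 … a_l}(z)` are the
same point `y`; subtracting the two resulting linear equations shows that
`(q_{a_1} ⋯ q_{a_n} - q_{a_1} ⋯ q_{a_l}) y` is an integer vector. -/
theorem exists_isReducedForm_coding (ω : ℕ → Fin N) {n : ℕ} (l : Fin n) :
    ∃ (p : Fin d → ℤ) (q : ℕ), IsReducedForm p q ∧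
      ratPoint p q = Φ.coding (eventuallyPeriodic (fun i : Fin n => ω i) l) ∧
      (q : ℝ) * ∏ i ∈ Finset.range n, Φ.ratio (ω i) ≤ 3 / 2 := by
  set ξ := eventuallyPeriodic (fun i : Fin n => ω i) l with hξ
  obtain ⟨P, hP⟩ := Φ.exists_wordMap_eq ξ n
  obtain ⟨P', hP'⟩ := Φ.exists_wordMap_eq ξ l
  have h1 := hP (Φ.coding (shift n ξ))
  have h2 := hP' (Φ.coding (shift l ξ))
  rw [← coding_eq_wordMap] at h1 h2
  rw [shift_eventuallyPeriodic, ← hξ] at h1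
  set Q : ℤ := ∏ i ∈ Finset.range n, Φ.q (ξ i) with hQ
  set Q' : ℤ := ∏ i ∈ Finset.range l, Φ.q (ξ i) with hQ'
  have hQpos : 0 < |(Q : ℝ)| := by
    rw [← inv_pos, ← Φ.prod_ratio]
    exact Φ.prod_ratio_pos _ _
  have hQQ : 2 * |(Q' : ℝ)| ≤ |(Q : ℝ)| := by
    have hprod : Q = Q' * ∏ i ∈ Finset.range (n - l), Φ.q (shift l ξ i) := by
      have hl := l.2
      have := Finset.prod_range_add (fun i => Φ.q (ξ i)) l (n - l)
      rwa [Nat.add_sub_cancel' hl.le] at this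
    have h3 := Φ.prod_ratio_le (shift l ξ) (n - l)
    have h4 : ((1 : ℝ) / 2) ^ (n - (l : ℕ)) ≤ 1 / 2 := by
      have hl := l.2
      exact pow_le_of_le_one (by norm_num) (by norm_num) (by omega)
    have h5 := Φ.prod_ratio_pos (shift l ξ) (n - l)
    rw [Φ.prod_ratio] at h3 h5
    have h6 := inv_anti₀ h5 (h3.trans h4)
    rw [inv_inv] at h6
    rw [hprod, Int.cast_mul, abs_mul]
    nlinarith [abs_nonneg (Q' : ℝ)]
  have hsub : ((Q - Q' : ℤ) : ℝ) • Φ.coding ξ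
      = WithLp.toLp 2 fun i => ((P i - P' i : ℤ) : ℝ) := by
    rw [Int.cast_sub, sub_smul, h1, h2, add_sub_add_left_eq_sub]
    ext i
    simp
  have hne : Q - Q' ≠ 0 := by
    intro h
    have : Q = Q' := by omega
    rw [this] at hQQ hQpos
    linarith
  obtain ⟨p, q, hred, hpq, hq⟩ := exists_isReducedForm hne hsub
  refine ⟨p, q, hred, hpq, ?_⟩
  have hprod : ∏ i ∈ Finset.range n, Φ.ratio (ω i) = |(Q : ℝ)|⁻¹ := by
    rw [hQ, ← Φ.prod_ratio]
    refine Finset.prod_congr rfl fun i hi => ?_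
    rw [hξ, eventuallyPeriodic_of_lt ω l (Finset.mem_range.1 hi)]
  rw [hprod, ← div_eq_mul_inv, div_le_iff₀ hQpos]
  push_cast at hq
  have := abs_sub (Q : ℝ) Q'
  linarith

theorem minLength_coding_le {n : ℕ} (a : Fin n → Fin N) (l : Fin n) :
    1 ≤ Φ.minLength (Φ.coding (eventuallyPeriodic a l)) ∧
      Φ.minLength (Φ.coding (eventuallyPeriodic a l)) ≤ n := by
  refine ⟨Nat.one_le_iff_ne_zero.2 fun h => ?_, Nat.sInf_le ⟨a, l, rfl⟩⟩
  have := Nat.sInf_mem (s := {m : ℕ | ∃ (b : Fin m → Fin N) (l' : Fin m),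
    Φ.coding (eventuallyPeriodic b l') = Φ.coding (eventuallyPeriodic a l)}) ⟨n, a, l, rfl⟩
  obtain ⟨b, l', -⟩ := this
  have h2 := l'.2
  change _ < Φ.minLength _ at h2
  omega

variable [NeZero N]

theorem coding_mem (ω : ℕ → Fin N) : Φ.coding ω ∈ Φ.selfSimilarSet := by
  rw [selfSimilarSet_eq_range]
  exact ⟨ω, rfl⟩

theorem isBounded_selfSimilarSet : Bornology.IsBounded Φ.selfSimilarSet := by
  rw [selfSimilarSet_eq_range]
  exact (isCompact_range Φ.continuous_coding).isBounded

theorem dist_coding_le_of_eq {ω η : ℕ → Fin N} {n : ℕ} (h : ∀ i < n, ω i = η i) :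
    dist (Φ.coding ω) (Φ.coding η)
      ≤ (∏ i ∈ Finset.range n, Φ.ratio (ω i)) * Metric.diam Φ.selfSimilarSet := by
  have e : (fun i : Fin n => η i) = fun i : Fin n => ω i := funext fun i => (h i i.2).symm
  rw [Φ.coding_eq_wordMap ω n, Φ.coding_eq_wordMap η n, e, dist_wordMap]
  refine mul_le_mul_of_nonneg_left ?_ (Φ.prod_ratio_pos ω n).le
  exact Metric.dist_le_diam_of_mem Φ.isBounded_selfSimilarSet (Φ.coding_mem _) (Φ.coding_mem _)

theorem StrongSeparation.coding_injective (hΦ : Φ.StrongSeparation) :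
    Function.Injective Φ.coding := by
  have h0 : ∀ ω η : ℕ → Fin N, Φ.coding ω = Φ.coding η →
      ω 0 = η 0 ∧ Φ.coding (shift 1 ω) = Φ.coding (shift 1 η) := by
    intro ω η h
    have e : ∀ ω : ℕ → Fin N, Φ.coding ω = Φ.map (ω 0) (Φ.coding (shift 1 ω)) := fun ω => by
      rw [coding_eq, show shift 1 ω = fun k => ω (k + 1) from funext fun k => by
        rw [shift, add_comm]]
    rw [e ω, e η] at h
    have h1 : ω 0 = η 0 := by
      by_contra hne
      refine Set.disjoint_left.1 (hΦ _ _ hne) ⟨_, Φ.coding_mem (shift 1 ω), rfl⟩ ?_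
      rw [h]
      exact ⟨_, Φ.coding_mem (shift 1 η), rfl⟩
    refine ⟨h1, ?_⟩
    rw [h1] at h
    have := Φ.dist_map (η 0) (Φ.coding (shift 1 ω)) (Φ.coding (shift 1 η))
    rw [h, dist_self, eq_comm, mul_eq_zero] at this
    exact dist_eq_zero.1 (this.resolve_left (Φ.ratio_pos _).ne')
  intro ω η h
  have h2 : ∀ n, Φ.coding (shift n ω) = Φ.coding (shift n η) := by
    intro n
    induction n with
    | zero => simpa [shift_zero] using h
    | succ n ih =>
      rw [← shift_shift 1 n, ← shift_shift 1 n]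
      exact (h0 _ _ ih).2
  exact funext fun n => (h0 _ _ (h2 n)).1

theorem two_le_of_entropy_lt (hent : Φ.entropy < -2 * Real.log (∑ a, Φ.weight a ^ 2)) :
    2 ≤ N := by
  by_contra hN
  obtain rfl : N = 1 := by
    have := NeZero.ne N
    omega
  have h1 : Φ.weight 0 = 1 := by simpa using Φ.sum_weight
  simp [entropy, h1] at hent

theorem simDim_pos (hN : 2 ≤ N) : 0 < Φ.simDim := by
  by_contra! hs
  have h1 : ∀ a, 1 ≤ Φ.weight a := fun a =>
    Real.one_le_rpow_of_pos_of_le_one_of_nonpos (Φ.ratio_pos a)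
      ((Φ.ratio_le a).trans (by norm_num)) hs
  have h2 : (N : ℝ) ≤ ∑ a, Φ.weight a := by
    simpa using Finset.sum_le_sum (s := Finset.univ) fun a _ => h1 a
  rw [sum_weight] at h2
  have h3 : (2 : ℝ) ≤ N := by exact_mod_cast hN
  linarith

theorem weight_lt_one (hN : 2 ≤ N) (a : Fin N) : Φ.weight a < 1 :=
  Real.rpow_lt_one (Φ.ratio_pos a).le ((Φ.ratio_le a).trans_lt (by norm_num)) (Φ.simDim_pos hN)

theorem prefixWeight_eq (ω : ℕ → Fin N) (n : ℕ) : Φ.prefixWeight ω n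
    = ENNReal.ofReal ((∏ i ∈ Finset.range n, Φ.ratio (ω i)) ^ Φ.simDim) := by
  rw [← Real.finsetProd_rpow _ _ fun i _ => (Φ.ratio_pos _).le,
    ENNReal.ofReal_prod_of_nonneg fun i _ => Real.rpow_nonneg (Φ.ratio_pos _).le _]
  rfl

/-- A block event produces a rational point of `X` close to `π(ω)`. -/
theorem exists_near_of_mem_blockEvent (hN : 2 ≤ N) {M : ℕ} {g : ℕ → NNReal}
    (hg : AntitoneOn g (Set.Ici 1)) (hg0 : 0 < g (5 * M)) {ψ : ENNReal}
    (hψ : ψ ≤ ENNReal.ofReal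
      (((2 * (Metric.diam Φ.selfSimilarSet + 1))⁻¹ * g (5 * M)) ^ Φ.simDim))
    {ω : ℕ → Fin N} (hω : ω ∈ Φ.blockEvent M ψ) :
    ∃ pq : (Fin d → ℤ) × ℕ, IsReducedForm pq.1 pq.2 ∧
      ratPoint pq.1 pq.2 ∈ Φ.selfSimilarSet ∧
      ‖Φ.coding ω - ratPoint pq.1 pq.2‖ < g (Φ.minLength (ratPoint pq.1 pq.2)) / pq.2 ∧
      dist (ratPoint pq.1 pq.2) (Φ.coding ω) ≤ Metric.diam Φ.selfSimilarSet * (1 / 2) ^ M := by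
  obtain ⟨l, hl, n, hn, m, hm, hw, he⟩ := hω
  set D := Metric.diam Φ.selfSimilarSet with hD
  have hD0 : 0 ≤ D := Metric.diam_nonneg
  have hln : M + l < 3 * M + n := by omega
  obtain ⟨p, q, hred, hpq, hq⟩ := Φ.exists_isReducedForm_coding ω (⟨M + l, hln⟩ : Fin (3 * M + n))
  have hlen := Φ.minLength_coding_le (fun i : Fin (3 * M + n) => ω i) ⟨M + l, hln⟩
  have hagree : ∀ k < 3 * M + n + m,
      ω k = eventuallyPeriodic (fun i : Fin (3 * M + n) => ω i) ⟨M + l, hln⟩ k := fun k hk =>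
    (eventuallyPeriodic_eq ω (⟨M + l, hln⟩ : Fin (3 * M + n)) he hk).symm
  set r := ∏ i ∈ Finset.range (3 * M + n), Φ.ratio (ω i) with hr
  set r' := ∏ i ∈ Finset.range m, Φ.ratio (shift (M + l) ω i) with hr'
  have hr0 : 0 < r := Φ.prod_ratio_pos _ _
  have hdist := Φ.dist_coding_le_of_eq hagree
  rw [← hpq] at hdist hlen
  have hprod : ∏ i ∈ Finset.range (3 * M + n + m), Φ.ratio (ω i) = r * r' := by
    rw [Finset.prod_range_add]
    congr 1
    exact Finset.prod_congr rfl fun i hi => by rw [← he i (Finset.mem_range.1 hi)]; rfl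
  have hr'g : r' ≤ (2 * (D + 1))⁻¹ * g (5 * M) := by
    have h1 := hw.trans hψ
    rw [prefixWeight_eq, ENNReal.ofReal_le_ofReal_iff (by positivity)] at h1
    exact (Real.rpow_le_rpow_iff (Φ.prod_ratio_pos _ _).le (by positivity)
      (Φ.simDim_pos hN)).1 h1
  have hgle : g (5 * M) ≤ g (Φ.minLength (ratPoint p q)) :=
    hg hlen.1 (Set.mem_Ici.2 (by omega)) (hlen.2.trans (by omega))
  have hgle' : (g (5 * M) : ℝ) ≤ g (Φ.minLength (ratPoint p q)) := by exact_mod_cast hgle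
  have hg0' : (0 : ℝ) < g (5 * M) := by exact_mod_cast hg0
  have hq0 : (0 : ℝ) < q := by exact_mod_cast hred.1
  refine ⟨(p, q), hred, ?_, ?_, ?_⟩
  · rw [hpq]
    exact Φ.coding_mem _
  · rw [← dist_eq_norm, lt_div_iff₀ hq0]
    rw [hprod, ← hD] at hdist
    have hr'D : r' * D ≤ g (5 * M) / 2 := by
      calc r' * D ≤ (2 * (D + 1))⁻¹ * g (5 * M) * D := by gcongr
        _ = g (5 * M) / 2 * (D / (D + 1)) := by field_simp
        _ ≤ g (5 * M) / 2 * 1 := by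
          gcongr
          exact div_le_one_of_le₀ (by linarith) (by linarith)
        _ = _ := mul_one _
    calc dist (Φ.coding ω) (ratPoint p q) * q ≤ r * r' * D * q := by gcongr
      _ = (q * r) * (r' * D) := by ring
      _ ≤ 3 / 2 * (g (5 * M) / 2) := by
        have : 0 ≤ r' := (Φ.prod_ratio_pos _ _).le
        gcongr
      _ < g (5 * M) := by linarith
      _ ≤ _ := hgle'
  · rw [dist_comm]
    refine hdist.trans ?_
    rw [mul_comm]
    gcongr
    refine (Φ.prod_ratio_le _ _).trans ?_
    exact pow_le_pow_of_le_one (by norm_num) (by norm_num) (by omega)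

end Codings

/-! ### Divergent series -/

/-- A condensation test in base `5` for the series `∑ n f(n)`. -/
theorem tsum_condensed_eq_top {f : ℕ → ENNReal} (hf : AntitoneOn f (Set.Ici 1)) (h1 : f 1 ≠ ⊤)
    (hsum : ∑' n : ℕ, ((n + 1 : ℕ) : ENNReal) * f (n + 1) = ⊤) :
    ∑' j : ℕ, ((5 ^ j : ℕ) : ENNReal) ^ 2 * f (5 ^ (j + 1)) = ⊤ := by
  have hle : ∑' n : ℕ, ((n + 1 : ℕ) : ENNReal) * f (n + 1)
      ≤ ∑' j : ℕ, ((5 ^ (j + 1) : ℕ) : ENNReal) ^ 2 * f (5 ^ j) := by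
    calc _ ≤ ∑' n : ℕ, ∑' j : ℕ,
          if Nat.log 5 (n + 1) = j then ((5 ^ (j + 1) : ℕ) : ENNReal) * f (5 ^ j) else 0 := by
          refine ENNReal.tsum_le_tsum fun n => ?_
          rw [tsum_ite_eq']
          refine mul_le_mul' ?_ (hf ?_ ?_ ?_)
          · exact_mod_cast (Nat.lt_pow_succ_log_self (by norm_num) (n + 1)).le
          · exact Set.mem_Ici.2 (Nat.one_le_pow _ _ (by norm_num))
          · exact Set.mem_Ici.2 (by omega)
          · exact Nat.pow_log_le_self 5 (by omega)
      _ = ∑' j : ℕ, ∑' n : ℕ,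
          if Nat.log 5 (n + 1) = j then ((5 ^ (j + 1) : ℕ) : ENNReal) * f (5 ^ j) else 0 :=
          ENNReal.tsum_comm
      _ ≤ _ := by
          refine ENNReal.tsum_le_tsum fun j => ?_
          calc _ ≤ ∑' n : ℕ, if n ∈ Finset.range (5 ^ (j + 1)) then
                ((5 ^ (j + 1) : ℕ) : ENNReal) * f (5 ^ j) else 0 := by
                refine ENNReal.tsum_le_tsum fun n => ?_
                by_cases h : Nat.log 5 (n + 1) = j
                · have := Nat.lt_pow_succ_log_self (b := 5) (by norm_num) (n + 1)
                  rw [h] at this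
                  rw [if_pos h, if_pos (Finset.mem_range.2 (by omega))]
                · rw [if_neg h]
                  exact zero_le
            _ = _ := by
                rw [tsum_eq_sum (s := Finset.range (5 ^ (j + 1))) fun n hn => if_neg hn,
                  Finset.sum_congr rfl fun n hn => if_pos hn, Finset.sum_const,
                  Finset.card_range, nsmul_eq_mul, sq, mul_assoc]
  rw [hsum, top_le_iff, tsum_eq_zero_add' ENNReal.summable] at hle
  have h2 : ((5 ^ (0 + 1) : ℕ) : ENNReal) ^ 2 * f (5 ^ 0) ≠ ⊤ :=
    ENNReal.mul_ne_top (by simp) (by simpa using h1)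
  have h3 := (ENNReal.add_eq_top.1 hle).resolve_left h2
  have h4 : ∀ j : ℕ, ((5 ^ (j + 1 + 1) : ℕ) : ENNReal) ^ 2 * f (5 ^ (j + 1))
      = 625 * (((5 ^ j : ℕ) : ENNReal) ^ 2 * f (5 ^ (j + 1))) := fun j => by
    push_cast
    ring
  simp only [h4] at h3
  rw [ENNReal.tsum_mul_left, ENNReal.mul_eq_top] at h3
  rcases h3 with h | h
  · exact h.2
  · exact absurd h.1 (by norm_num)

theorem tsum_min_one_eq_top {a : ℕ → ENNReal} (ha : ∀ j, a j ≠ ⊤) (h : ∑' j, a j = ⊤) :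
    ∑' j, min (a j) 1 = ⊤ := by
  by_contra hne
  lift a to ℕ → NNReal using ha
  have e : ∀ j, min (a j : ENNReal) 1 = ((min (a j) 1 : NNReal) : ENNReal) := fun j => by
    rw [ENNReal.coe_min, ENNReal.coe_one]
  simp only [e] at hne
  have hs : Summable fun j => min (a j) 1 := ENNReal.tsum_coe_ne_top_iff_summable.1 hne
  have ht := NNReal.tendsto_cofinite_zero_of_summable hs
  have hev : ∀ᶠ j in cofinite, min (a j) 1 = a j := by
    filter_upwards [ht.eventually (gt_mem_nhds one_pos)] with j hj
    rcases min_lt_iff.1 hj with h' | h'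
    · exact min_eq_left h'.le
    · exact absurd h' (lt_irrefl 1)
  have hs' : Summable a := NNReal.summable_coe.1 <|
    (summable_congr_cofinite (hev.mono fun j hj => by rw [hj])).1 (NNReal.summable_coe.2 hs)
  exact ENNReal.tsum_coe_ne_top_iff_summable.2 hs' h

variable {d N : ℕ} [NeZero N] (Φ : RationalIFS d N)

/-- Since `diam X_a ≤ r_a diam X` and `∑ r_a ^ s = 1` over the words `a` of any given length, the
divergence hypothesis on `g` says that `∑ n g(n) ^ s` diverges. -/
theorem tsum_mul_rpow_eq_top (hN : 2 ≤ N) (g : ℕ → NNReal) {κ : ℝ} (hκ : 0 < κ)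
    (hdiv : ∑' n : ℕ, ∑ a : Fin (n + 1) → Fin N,
      ENNReal.ofReal (((n + 1 : ℕ) : ℝ) * (Metric.diam (Φ.cylinder a) * g (n + 1)) ^ Φ.simDim)
        = ⊤) :
    ∑' n : ℕ, ((n + 1 : ℕ) : ENNReal) * ENNReal.ofReal ((κ * g (n + 1)) ^ Φ.simDim) = ⊤ := by
  set D := Metric.diam Φ.selfSimilarSet with hD
  have hD0 : 0 ≤ D := Metric.diam_nonneg
  have hs := Φ.simDim_pos hN
  have hdiam : ∀ (n : ℕ) (a : Fin n → Fin N),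
      Metric.diam (Φ.cylinder a) ≤ (∏ i, Φ.ratio (a i)) * D := by
    intro n a
    have hr : 0 ≤ ∏ i, Φ.ratio (a i) := Finset.prod_nonneg fun i _ => (Φ.ratio_pos _).le
    let ω : ℕ → Fin N := fun k => if h : k < n then a ⟨k, h⟩ else 0
    have e : (fun i : Fin n => ω i) = a := funext fun i => by simp [ω]
    refine Metric.diam_le_of_forall_dist_le (by positivity) ?_
    rintro _ ⟨x, hx, rfl⟩ _ ⟨y, hy, rfl⟩
    have h := Φ.dist_wordMap ω n x y
    rw [e] at h
    rw [h, Finset.prod_range, Finset.prod_congr rfl fun i _ => by rw [congrFun e i]]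
    gcongr
    exact Metric.dist_le_diam_of_mem Φ.isBounded_selfSimilarSet hx hy
  have hterm : ∀ n : ℕ, ∑ a : Fin (n + 1) → Fin N,
      ENNReal.ofReal (((n + 1 : ℕ) : ℝ) * (Metric.diam (Φ.cylinder a) * g (n + 1)) ^ Φ.simDim)
      ≤ ENNReal.ofReal ((D / κ) ^ Φ.simDim) *
        (((n + 1 : ℕ) : ENNReal) * ENNReal.ofReal ((κ * g (n + 1)) ^ Φ.simDim)) := by
    intro n
    calc _ ≤ ∑ a : Fin (n + 1) → Fin N, ENNReal.ofReal (((n + 1 : ℕ) : ℝ) *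
          ((D / κ) ^ Φ.simDim * (κ * g (n + 1)) ^ Φ.simDim)) *
            ∏ i, ENNReal.ofReal (Φ.weight (a i)) := by
          refine Finset.sum_le_sum fun a _ => ?_
          have hr : 0 ≤ ∏ i, Φ.ratio (a i) := Finset.prod_nonneg fun i _ => (Φ.ratio_pos _).le
          rw [← ENNReal.ofReal_prod_of_nonneg fun i _ => (Φ.weight_pos _).le,
            ← ENNReal.ofReal_mul (by positivity)]
          refine ENNReal.ofReal_le_ofReal ?_
          have e : ∏ i, Φ.weight (a i) = (∏ i, Φ.ratio (a i)) ^ Φ.simDim :=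
            Real.finsetProd_rpow _ _ (fun i _ => (Φ.ratio_pos _).le) _
          rw [e, ← Real.mul_rpow (by positivity) (by positivity), mul_assoc,
            ← Real.mul_rpow (by positivity) hr]
          refine mul_le_mul_of_nonneg_left (Real.rpow_le_rpow
            (mul_nonneg Metric.diam_nonneg (NNReal.coe_nonneg _)) ?_ hs.le) (by positivity)
          calc Metric.diam (Φ.cylinder a) * g (n + 1)
              ≤ (∏ i, Φ.ratio (a i)) * D * g (n + 1) := by gcongr; exact hdiam _ a
            _ = D / κ * (κ * g (n + 1)) * ∏ i, Φ.ratio (a i) := by field_simp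
      _ = ENNReal.ofReal (((n + 1 : ℕ) : ℝ) *
          ((D / κ) ^ Φ.simDim * (κ * g (n + 1)) ^ Φ.simDim)) := by
          rw [← Finset.mul_sum, ← Fintype.sum_pow (fun a => ENNReal.ofReal (Φ.weight a)), sum_ofReal_weight, one_pow, mul_one]
      _ = _ := by
          rw [ENNReal.ofReal_mul (by positivity), ENNReal.ofReal_mul (by positivity),
            ENNReal.ofReal_natCast]
          ring
  have h := ENNReal.tsum_le_tsum hterm
  rw [hdiv, top_le_iff, ENNReal.tsum_mul_left, ENNReal.mul_eq_top] at h
  rcases h with h | h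
  · exact h.2
  · exact absurd h.1 ENNReal.ofReal_ne_top

/-! ### Assembling the blocks -/

theorem ae_frequently_mem_blockEvent {c ρ : NNReal} (hc0 : 0 < c)
    (hc : ∀ a, (c : ENNReal) ≤ ENNReal.ofReal (Φ.weight a)) (hρ1 : ρ < 1)
    (hρ : ∀ a, ENNReal.ofReal (Φ.weight a) ≤ ρ) {f : ℕ → ENNReal} (hf : ∀ j, f j ≠ ⊤)
    (hsum : ∑' j : ℕ, ((5 ^ j : ℕ) : ENNReal) ^ 2 * f j = ⊤) :
    ∀ᵐ ω ∂Φ.bernoulli, ∃ᶠ j in atTop, ∃ ψ, (ρ : ENNReal) ^ (5 ^ j) ≤ ψ ∧ ψ ≤ f j ∧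
      ω ∈ Φ.blockEvent (5 ^ j) ψ := by
  have h5 : ∀ j, (((5 ^ j : ℕ) : ENNReal) ^ 2) ≠ 0 := fun j => by positivity
  have h5' : ∀ j, (((5 ^ j : ℕ) : ENNReal) ^ 2) ≠ ⊤ := fun j =>
    ENNReal.pow_ne_top (ENNReal.natCast_ne_top _)
  let ψ : ℕ → ENNReal := fun j => min (f j) (((5 ^ j : ℕ) : ENNReal) ^ 2)⁻¹
  have hψ : ∀ j, ((5 ^ j : ℕ) : ENNReal) ^ 2 * ψ j = min (((5 ^ j : ℕ) : ENNReal) ^ 2 * f j) 1 := by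
    intro j
    simp only [ψ]
    rw [mul_min, ENNReal.mul_inv_cancel (h5 j) (h5' j)]
  have hψsum : ∑' j, ((5 ^ j : ℕ) : ENNReal) ^ 2 * ψ j = ⊤ := by
    simp only [hψ]
    exact tsum_min_one_eq_top (fun j => ENNReal.mul_ne_top (h5' j) (hf j)) hsum
  -- Blocks whose threshold is too small for words that fit into the block are dropped.
  let B : ℕ → Set (ℕ → Fin N) := fun j =>
    {ω | (ρ : ENNReal) ^ (5 ^ j) ≤ ψ j ∧ ω ∈ Φ.blockEvent (5 ^ j) (ψ j)}
  have hB : ∀ j, MeasurableSet (B j) := fun j =>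
    (MeasurableSet.const _).inter (Φ.measurableSet_blockEvent _ _)
  set K : NNReal := c ^ 2 * (2 + 2 * (1 - ρ)⁻¹)⁻¹ with hK
  have hK0 : (K : ENNReal) ≠ 0 := by
    have : 0 < K := by positivity
    exact_mod_cast this.ne'
  have hle : ∀ j, (K : ENNReal) * (((5 ^ j : ℕ) : ENNReal) ^ 2 * ψ j)
      ≤ Φ.bernoulli (B j) + K * (((5 ^ j : ℕ) : ENNReal) ^ 2 * (ρ : ENNReal) ^ (5 ^ j)) := by
    intro j
    by_cases h : (ρ : ENNReal) ^ (5 ^ j) ≤ ψ j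
    · refine le_trans ?_ le_self_add
      have e : B j = Φ.blockEvent (5 ^ j) (ψ j) := Set.ext fun ω => and_iff_right h
      rw [e]
      exact Φ.le_bernoulli_blockEvent hc hρ1 hρ (by positivity)
        ((hψ j).le.trans (min_le_right _ _)) h
    · refine le_trans ?_ le_add_self
      gcongr
      exact (not_le.1 h).le
  have hgeom : ∑' j, (((5 ^ j : ℕ) : ENNReal) ^ 2 * (ρ : ENNReal) ^ (5 ^ j)) ≠ ⊤ := by
    have h1 : Summable fun n : ℕ => (n : NNReal) ^ 2 * ρ ^ n := by
      rw [← NNReal.summable_coe]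
      push_cast
      exact summable_pow_mul_geometric_of_norm_lt_one 2 (by simpa using hρ1)
    have h2 := NNReal.summable_comp_injective h1 (Nat.pow_right_injective 
      (by norm_num : 2 ≤ 5))
    have h3 := ENNReal.tsum_coe_ne_top_iff_summable.2 h2
    refine ne_of_eq_of_ne (tsum_congr fun j => ?_) h3
    simp
  have hBsum : ∑' j, Φ.bernoulli (B j) = ⊤ := by
    have h := ENNReal.tsum_le_tsum hle
    rw [ENNReal.tsum_mul_left, hψsum, ENNReal.mul_top hK0, top_le_iff, ENNReal.tsum_add,
      ENNReal.tsum_mul_left] at h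
    exact (ENNReal.add_eq_top.1 h).resolve_right
      (ENNReal.mul_ne_top ENNReal.coe_ne_top hgeom)
  have hae := Φ.ae_frequently_of_blocks hB (b := fun j => 5 ^ j)
    (fun i j hij => Nat.pow_le_pow_right (by norm_num) hij)
    (fun j ω η h => and_congr_right fun _ => Φ.mem_blockEvent_congr fun k h1 h2 =>
      h k h1 (by rw [pow_succ]; omega)) hBsum
  filter_upwards [hae] with ω hω
  exact hω.mono fun j hj => ⟨ψ j, hj.1, min_le_left _ _, hj.2⟩

theorem bernoulli_singleton {ρ : NNReal} (hρ1 : ρ < 1)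
    (hρ : ∀ a, ENNReal.ofReal (Φ.weight a) ≤ ρ) (ω : ℕ → Fin N) : Φ.bernoulli {ω} = 0 := by
  have h1 : ∀ n : ℕ, Φ.bernoulli {ω} ≤ (ρ : ENNReal) ^ n := fun n => by
    refine le_trans ?_ (Φ.prefixWeight_le_pow hρ ω n)
    rw [← Φ.bernoulli_cylinder]
    exact measure_mono (by rintro _ rfl i _; rfl)
  exact le_antisymm (ge_of_tendsto' (ENNReal.tendsto_pow_atTop_nhds_zero_of_lt_one
    (by exact_mod_cast hρ1)) h1) zero_le

theorem StrongSeparation.ae_coding_ne_ratPoint (hΦ : Φ.StrongSeparation) {ρ : NNReal}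
    (hρ1 : ρ < 1) (hρ : ∀ a, ENNReal.ofReal (Φ.weight a) ≤ ρ) :
    ∀ᵐ ω ∂Φ.bernoulli, ∀ pq : (Fin d → ℤ) × ℕ, Φ.coding ω ≠ ratPoint pq.1 pq.2 := by
  rw [ae_all_iff]
  intro pq
  rw [ae_iff]
  have hsub : {ω | ¬ Φ.coding ω ≠ ratPoint pq.1 pq.2}.Subsingleton := by
    intro ω hω η hη
    exact hΦ.coding_injective Φ ((not_not.1 hω).trans (not_not.1 hη).symm)
  rcases hsub.eq_empty_or_singleton with h | ⟨ω, h⟩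
  · rw [h, measure_empty]
  · rw [h, Φ.bernoulli_singleton hρ1 hρ]

theorem exists_weight_bounds (hN : 2 ≤ N) : ∃ c ρ : NNReal, 0 < c ∧ ρ < 1 ∧
    (∀ a, (c : ENNReal) ≤ ENNReal.ofReal (Φ.weight a)) ∧
    ∀ a, ENNReal.ofReal (Φ.weight a) ≤ ρ := by
  have hne : (Finset.univ : Finset (Fin N)).Nonempty := ⟨0, Finset.mem_univ _⟩
  obtain ⟨a, -, ha⟩ := Finset.exists_min_image Finset.univ Φ.weight hne
  obtain ⟨b, -, hb⟩ := Finset.exists_max_image Finset.univ Φ.weight hne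
  refine ⟨(Φ.weight a).toNNReal, (Φ.weight b).toNNReal, Real.toNNReal_pos.2 (Φ.weight_pos a), ?_,
    fun i => ENNReal.ofReal_le_ofReal (ha i (Finset.mem_univ i)),
    fun i => ENNReal.ofReal_le_ofReal (hb i (Finset.mem_univ i))⟩
  rw [Real.toNNReal_lt_one]
  exact Φ.weight_lt_one hN b

end

end RationalIFS

open RationalIFS in
theorem corollary2p7 {d N : ℕ} [NeZero N] (Φ : RationalIFS d N)
    (hΦ : Φ.StrongSeparation)
    (hent : Φ.entropy < -2 * Real.log (∑ a, Φ.weight a ^ 2))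
    (g : ℕ → NNReal) (hg : AntitoneOn g (Set.Ici 1))
    (hdiv : ∑' n : ℕ, ∑ a : Fin (n + 1) → Fin N,
      ENNReal.ofReal (((n + 1 : ℕ) : ℝ) * (Metric.diam (Φ.cylinder a) * g (n + 1)) ^ Φ.simDim)
        = ⊤) :
    Φ.selfSimilarMeasure (Φ.approximable g) = 1 := by
  have hN := Φ.two_le_of_entropy_lt hent
  have hs := Φ.simDim_pos hN
  obtain ⟨c, ρ, hc0, hρ1, hc, hρ⟩ := Φ.exists_weight_bounds hN
  have hρ0 : (ρ : ENNReal) ≠ 0 := ((Φ.ofReal_weight_pos 0).trans_le (hρ 0)).ne'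
  have hD0 : 0 ≤ Metric.diam Φ.selfSimilarSet := Metric.diam_nonneg
  -- The factor `1 / (2 (diam X + 1))` absorbs the diameter of `X` and the comparison of the
  -- reduced denominator with `|q_{a_1} ⋯ q_{a_n}|`.
  set κ : ℝ := (2 * (Metric.diam Φ.selfSimilarSet + 1))⁻¹ with hκ
  have hκ0 : 0 < κ := by positivity
  let f : ℕ → ENNReal := fun n => ENNReal.ofReal ((κ * g n) ^ Φ.simDim)
  have hf : AntitoneOn f (Set.Ici 1) := by
    intro m hm n hn hmn
    have : (g n : ℝ) ≤ g m := by exact_mod_cast hg hm hn hmn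
    exact ENNReal.ofReal_le_ofReal (by gcongr)
  have hcond := tsum_condensed_eq_top hf ENNReal.ofReal_ne_top
    (Φ.tsum_mul_rpow_eq_top hN g hκ0 hdiv)
  have hae : ∀ᵐ ω ∂Φ.bernoulli, Φ.coding ω ∈ Φ.approximable g := by
    filter_upwards [Φ.ae_frequently_mem_blockEvent hc0 hc hρ1 hρ
      (f := fun j => f (5 ^ (j + 1))) (fun j => ENNReal.ofReal_ne_top) hcond,
      hΦ.ae_coding_ne_ratPoint Φ hρ1 hρ] with ω hω hirr
    refine ⟨Φ.coding_mem ω, fun hfin => ?_⟩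
    -- Finitely many rational points would keep a positive distance from `π(ω)`.
    set T : Set (EuclideanSpace ℝ (Fin d)) := (fun pq => ratPoint pq.1 pq.2) ''
      {pq : (Fin d → ℤ) × ℕ |
      IsReducedForm pq.1 pq.2 ∧ ratPoint pq.1 pq.2 ∈ Φ.selfSimilarSet ∧
      ‖Φ.coding ω - ratPoint pq.1 pq.2‖ < g (Φ.minLength (ratPoint pq.1 pq.2)) / pq.2} with hT
    have hTc : IsOpen Tᶜ := (hfin.image _).isClosed.isOpen_compl
    have hωT : Φ.coding ω ∈ Tᶜ := by
      rintro ⟨pq, -, h⟩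
      exact hirr pq h.symm
    obtain ⟨δ, hδ, hball⟩ := Metric.isOpen_iff.1 hTc _ hωT
    have hlim : Tendsto (fun j : ℕ => Metric.diam Φ.selfSimilarSet * ((1 : ℝ) / 2) ^ (5 ^ j)) atTop
        (𝓝 0) := by
      have h1 : Tendsto (fun n : ℕ => Metric.diam Φ.selfSimilarSet * ((1 : ℝ) / 2) ^ n) atTop
          (𝓝 0) := by
        simpa using (tendsto_pow_atTop_nhds_zero_of_lt_one (by norm_num : (0 : ℝ) ≤ 1 / 2)
          (by norm_num)).const_mul (Metric.diam Φ.selfSimilarSet)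
      exact h1.comp (tendsto_pow_atTop_atTop_of_one_lt (by norm_num : 1 < 5))
    obtain ⟨j, ⟨ψ, hψρ, hψf, hmem⟩, hj⟩ :=
      (hω.and_eventually (hlim.eventually (gt_mem_nhds hδ))).exists
    have e : 5 ^ (j + 1) = 5 * 5 ^ j := pow_succ' 5 j
    simp only [f, e] at hψf
    have hg0 : 0 < g (5 * 5 ^ j) := by
      refine pos_iff_ne_zero.2 fun h0 => ?_
      rw [h0, NNReal.coe_zero, mul_zero, Real.zero_rpow hs.ne', ENNReal.ofReal_zero] at hψf
      exact pow_ne_zero _ hρ0 (le_antisymm (hψρ.trans hψf) zero_le)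
    obtain ⟨pq, h1, h2, h3, h4⟩ := Φ.exists_near_of_mem_blockEvent hN hg hg0 hψf hmem
    exact hball (Metric.mem_ball.2 (h4.trans_lt hj)) ⟨pq, ⟨h1, h2, h3⟩, rfl⟩
  have h1 : Φ.bernoulli (Φ.coding ⁻¹' Φ.approximable g) = 1 := prob_compl_eq_zero_iff₀
    (NullMeasurableSet.of_compl (NullMeasurableSet.of_null hae)) |>.1 hae
  rw [selfSimilarMeasure_eq_map]
  have : IsProbabilityMeasure (Φ.bernoulli.map Φ.coding) :=
    Measure.isProbabilityMeasure_map Φ.measurable_coding.aemeasurable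
  exact le_antisymm prob_le_one
    (h1.ge.trans (Measure.le_map_apply Φ.measurable_coding.aemeasurable _))
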